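/- For sets $D,S$ of positive integers, the distance game $\mathrm{GDist}(D,S)$ is played on a finite simple graph by two players, Left and Right, who alternately place a piece of their own on an empty vertex. A Left piece and a Right piece may never be at graph distance $d$ with $d\in D$, and two pieces of the same player may never be at graph distance $s$ with $s\in S$ (vertices in different components have distance $\infty$). Pieces are never moved or removed, and the player who makes the last move wins. A position is a finite graph some of whose vertices carry pieces, placed so that these restrictions hold. For fixed $D,S$ we regard $\mathrm{GDist}(D,S)$ as the decision problem: given a position, does Left, moving next, have a winning strategy? The game Col is $\mathrm{GDist}(\varnothing,\{1\})$. A decision problem is PSPACE-hard if every language in PSPACE has a polynomial-time many-one reduction to it. **Corollary.** Suppose that Col is PSPACE-hard. Let $k\ge 1$, let $S=\{1,2,\dots,k\}$, and let $D\subset S$ with $\max(D)<k$ (where $D=\varnothing$ is allowed). Then $\mathrm{GDist}(D,S)$ is PSPACE-hard. -/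

import Mathlib

/-! ## Decision problems, PSPACE and polynomial-time reductions -/

namespace Complexity

open Turing

/-- A decision problem: a set of instances, written as words over a finite alphabet, and the
property to be decided. -/
structure DecisionProblem where
  /-- the instances -/
  Inst : Type
  /-- the alphabet -/
  Alphabet : Type
  /-- the alphabet is finite -/
  [alphabetFin : Fintype Alphabet]
  /-- how instances are written as words -/
  enc : Computability.Encoding Inst Alphabet
  /-- the property to be decided -/
  Yes : Inst → Prop

/-- The number of symbols that a configuration of a multi-stack Turing machine stores. -/
def space (tm : FinTM2) (c : tm.Cfg) : ℕ :=
  letI := tm.kFin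
  ∑ k : tm.K, (c.stk k).length

open Classical in
/-- `L` is in PSPACE: some Turing machine decides `L` (on every input it halts with the answer
`true` or `false` as its output), and for some polynomial `p` no configuration that it reaches on
an input `w` stores more than `p |w|` symbols. -/
def InPSPACE (L : Language Bool) : Prop :=
  ∃ (M : TM2ComputableAux Bool Bool) (p : Polynomial ℕ), ∀ w : List Bool,
    Nonempty (TM2Outputs M.tm (w.map M.inputAlphabet.invFun)
      (some ([decide (w ∈ L)].map M.outputAlphabet.invFun))) ∧
    ∀ c : M.tm.Cfg,
      StateTransition.Reaches M.tm.step (initList M.tm (w.map M.inputAlphabet.invFun)) c →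
        space M.tm c ≤ p.eval w.length

/-- A polynomial-time many-one (Karp) reduction from the language `L` to the problem `Q`: a map
from words to instances of `Q`, computed by a Turing machine in polynomially many steps, that
carries membership in `L` to the property `Q` asks for. -/
def PolyTimeReducesTo (L : Language Bool) (Q : DecisionProblem) : Prop :=
  ∃ f : List Bool → Q.Inst,
    Nonempty (TM2ComputableInPolyTime (id : List Bool → List Bool) Q.enc.encode f) ∧
    ∀ w, w ∈ L ↔ Q.Yes (f w)

/-- `Q` is PSPACE-hard: every language in PSPACE has a polynomial-time reduction to `Q`. -/
def PSPACEHard (Q : DecisionProblem) : Prop :=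
  ∀ L : Language Bool, InPSPACE L → PolyTimeReducesTo L Q

end Complexity

/-! ## Distance games -/

namespace DistanceGame

/-- The two players; a piece is owned by one of them. -/
inductive Player
  | left
  | right
  deriving DecidableEq

instance : Fintype Player :=
  ⟨{.left, .right}, fun p => by cases p <;> simp⟩

/-- The opponent of a player. -/
def Player.other : Player → Player
  | .left => .right
  | .right => .left

section Rules

variable {V : Type} [DecidableEq V]

/-- `c` says which vertices carry a piece (`none`: empty vertex) and whose. It is legal for the
forbidden distances `D` (pieces of different players) and `S` (pieces of the same player) if no two
pieces are at a forbidden distance. Vertices in different components are at distance `⊤`. -/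
def IsLegal (D S : Set ℕ) (G : SimpleGraph V) (c : V → Option Player) : Prop :=
  (∀ u v, c u = some .left → c v = some .right → ∀ d ∈ D, G.edist u v ≠ (d : ℕ∞)) ∧
  (∀ p u v, u ≠ v → c u = some p → c v = some p → ∀ s ∈ S, G.edist u v ≠ (s : ℕ∞))

/-- Player `p` may place a piece on `v` when the pieces on the board are `c`. -/
def CanPlace (D S : Set ℕ) (G : SimpleGraph V) (p : Player) (c : V → Option Player) (v : V) :
    Prop :=
  c v = none ∧ IsLegal D S G (Function.update c v (some p))

/-- Player `p`, who is next to move, has a winning strategy from the pieces `c`; the player who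
makes the last move wins. That is, `p` has a move after which `p` wins whatever the reply is (and
wins at once if there is no reply). -/
inductive WinsMovingNext (D S : Set ℕ) (G : SimpleGraph V) (p : Player) :
    (V → Option Player) → Prop
  | intro (c : V → Option Player) (v : V) (hv : CanPlace D S G p c v)
      (h : ∀ w, CanPlace D S G p.other (Function.update c v (some p)) w →
        WinsMovingNext D S G p
          (Function.update (Function.update c v (some p)) w (some p.other))) :
      WinsMovingNext D S G p c

end Rules

/-- A finite graph with pieces on some of its vertices. The vertices are `0, …, n - 1`, where `n` is
the length of `cells`; `cells` lists their contents and `edges` lists the edges. -/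
structure Board where
  /-- the content of each vertex -/
  cells : List (Option Player)
  /-- the edges -/
  edges : List (ℕ × ℕ)
  /-- each edge joins two different vertices -/
  edges_valid : ∀ e ∈ edges, e.1 < cells.length ∧ e.2 < cells.length ∧ e.1 ≠ e.2

/-- The graph of a board. -/
def Board.graph (b : Board) : SimpleGraph (Fin b.cells.length) :=
  SimpleGraph.fromRel fun i j => ((i : ℕ), (j : ℕ)) ∈ b.edges

/-- The pieces on a board. -/
def Board.pieces (b : Board) (i : Fin b.cells.length) : Option Player :=
  b.cells.get i

/-- The positions of the distance game with forbidden distances `D` and `S`. -/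
abbrev Position (D S : Set ℕ) : Type :=
  {b : Board // IsLegal D S b.graph b.pieces}

/-- The alphabet in which boards are written. -/
inductive Sym
  | cell (c : Option Player)
  | tick
  | comma
  | semicolon
  deriving DecidableEq, Fintype

/-- An edge is written as its two end points, in unary, each followed by a separator. -/
def encodeEdge (e : ℕ × ℕ) : List Sym :=
  List.replicate e.1 Sym.tick ++ Sym.comma :: (List.replicate e.2 Sym.tick ++ [Sym.semicolon])

/-- A board is written as the contents of its vertices followed by the list of its edges. (As every
vertex takes up a symbol of its own, the unary numerals of the end points are at most as long as
that list of contents.) -/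
def Board.encode (b : Board) : List Sym :=
  b.cells.map Sym.cell ++ b.edges.flatMap encodeEdge

theorem replicate_tick_append_inj {a b : ℕ} {x : Sym} (hx : x ≠ Sym.tick) {l l' : List Sym}
    (h : List.replicate a Sym.tick ++ x :: l = List.replicate b Sym.tick ++ x :: l') :
    a = b ∧ l = l' := by
  induction a generalizing b with
  | zero =>
    cases b with
    | zero => simpa using h
    | succ b => simp [List.replicate_succ, hx] at h
  | succ a ih =>
    cases b with
    | zero => simp [List.replicate_succ, hx.symm] at h
    | succ b =>
      simp only [List.replicate_succ, List.cons_append, List.cons.injEq, true_and] at h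
      exact ⟨congrArg Nat.succ (ih h).1, (ih h).2⟩

theorem encodeEdges_injective {l l' : List (ℕ × ℕ)}
    (h : l.flatMap encodeEdge = l'.flatMap encodeEdge) : l = l' := by
  induction l generalizing l' with
  | nil =>
    cases l' with
    | nil => rfl
    | cons e l' => simp [encodeEdge] at h
  | cons e l ih =>
    cases l' with
    | nil => simp [encodeEdge] at h
    | cons e' l' =>
      simp only [List.flatMap_cons, encodeEdge, List.append_assoc, List.cons_append,
        List.nil_append] at h
      obtain ⟨h1, h2⟩ := replicate_tick_append_inj (by simp) h
      obtain ⟨h3, h4⟩ := replicate_tick_append_inj (by simp) h2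
      rw [ih h4, Prod.ext h1 h3]

theorem encodeCells_injective {l l' : List (Option Player)} {m m' : List (ℕ × ℕ)}
    (h : l.map Sym.cell ++ m.flatMap encodeEdge = l'.map Sym.cell ++ m'.flatMap encodeEdge) :
    l = l' ∧ m = m' := by
  have key : ∀ (c : Option Player) (r : List Sym) (m : List (ℕ × ℕ)),
      m.flatMap encodeEdge ≠ Sym.cell c :: r := by
    intro c r m hm
    cases m with
    | nil => simp at hm
    | cons e m =>
      obtain ⟨a, b⟩ := e
      cases a <;> simp [encodeEdge, List.replicate_succ] at hm
  induction l generalizing l' with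
  | nil =>
    cases l' with
    | nil => exact ⟨rfl, encodeEdges_injective (by simpa using h)⟩
    | cons c l' => exact absurd h (key _ _ _)
  | cons c l ih =>
    cases l' with
    | nil => exact absurd h.symm (key _ _ _)
    | cons c' l' =>
      simp only [List.map_cons, List.cons_append, List.cons.injEq, Sym.cell.injEq] at h
      obtain ⟨h1, h2⟩ := ih h.2
      exact ⟨by rw [h.1, h1], h2⟩

theorem Board.encode_injective : Function.Injective Board.encode := by
  rintro ⟨l, m, _⟩ ⟨l', m', _⟩ h
  obtain ⟨rfl, rfl⟩ := encodeCells_injective h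
  rfl

/-- The encoding of positions as words. -/
noncomputable def positionEncoding (D S : Set ℕ) : Computability.Encoding (Position D S) Sym where
  encode b := b.1.encode
  decode := Function.partialInv fun b : Position D S => b.1.encode
  decode_encode :=
    Function.partialInv_left (Board.encode_injective.comp Subtype.val_injective)

/-- The distance game with forbidden distances `D` (different players) and `S` (same player), as a
decision problem: given a position, does Left, moving next, have a winning strategy? -/
noncomputable def distanceGame (D S : Set ℕ) : Complexity.DecisionProblem where
  Inst := Position D S
  Alphabet := Sym
  enc := positionEncoding D S
  Yes b := WinsMovingNext D S b.1.graph .left b.1.pieces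

/-- Col: adjacent vertices cannot be coloured with the same colour. -/
noncomputable def col : Complexity.DecisionProblem :=
  distanceGame ∅ {1}

end DistanceGame

/-!
The theorem holds because Col reduces in polynomial time to the distance game with the forbidden
distances `D` and `{1, …, k}`, where `d < k` for all `d ∈ D`.

Every edge `(u, v)` of a Col position is replaced by a copy of a `gadget`: a path of length `k` from
`u` to `v`, and a second path of length `2 * ⌈k / 2⌉` with a Left piece at one end and a Right piece
at the other, whose middle vertex is joined to the vertices number `⌊k / 2⌋` and `⌈k / 2⌉` of the
first path. Then

* adjacent vertices of the old graph are at distance exactly `k` in the new one, and nonadjacent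
  vertices are at a larger distance. As `k` is forbidden for pieces of the same player, but neither
  `k` nor a larger number is forbidden for pieces of different players, the restrictions between old
  vertices are those of Col;
* every new vertex without a piece is at distance at most `k` from a Left piece and from a Right
  piece, so that nobody can play there;
* the new pieces are at distance `k + 1` or more from the old vertices, at distance `k` or more from
  each other, and at distance `k + 1` or more from each other if they belong to the same player. So
  they are legal and restrict no move on an old vertex.

These facts make up `isBlockedEmbedding_expand`. The upper bounds for distances come from the two
paths, the lower bounds from functions on the vertices that change by at most `1` along every edge
(`le_edist_of_potential`). By `IsBlockedEmbedding.winsMovingNext_extend_iff` the two positions then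
have the same winner.

The replacement is computed by a stack machine that reads a position once from left to right
(`stepsTo_replaceMachine`): it counts the vertices written so far, in unary, and at the end of every
edge it writes the edges of a gadget, taking the numbers of the vertices from this counter and from
counters for the two end points. A reduction of a language to Col is followed by this machine; that
polynomial-time machines can be composed is `nonempty_computableInPolyTime_comp`, which rests on a
step-by-step simulation of a machine within a larger one (`stepsTo_embedStmt`).
-/

/-! ### Runs of state transition systems -/

namespace Complexity

open Turing StateTransition

/-- The transition function `f` leads from `a` to `b` in at most `t` steps. This is the
propositional counterpart of `StateTransition.EvalsToInTime`. -/
def StepsTo {α : Type*} (f : α → Option α) (t : ℕ) (a b : α) : Prop :=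
  ∃ n ≤ t, (flip bind f)^[n] (some a) = some b

section StepsTo

variable {α : Type*} {f : α → Option α} {s t : ℕ} {a b c : α}

theorem StepsTo.refl (f : α → Option α) (t : ℕ) (a : α) : StepsTo f t a a :=
  ⟨0, Nat.zero_le _, rfl⟩

theorem StepsTo.trans (h : StepsTo f s a b) (h' : StepsTo f t b c) : StepsTo f (s + t) a c := by
  obtain ⟨m, hm, h⟩ := h
  obtain ⟨n, hn, h'⟩ := h'
  exact ⟨n + m, by omega, by rw [Function.iterate_add_apply, h, h']⟩

theorem StepsTo.mono (h : StepsTo f s a b) (hst : s ≤ t) : StepsTo f t a b := by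
  obtain ⟨m, hm, h⟩ := h
  exact ⟨m, hm.trans hst, h⟩

theorem StepsTo.single (h : f a = some b) : StepsTo f 1 a b :=
  ⟨1, le_rfl, h⟩

theorem StepsTo.head (h : f a = some b) (h' : StepsTo f t b c) : StepsTo f (t + 1) a c := by
  rw [add_comm]
  exact (StepsTo.single h).trans h'

theorem iterate_bind_none (f : α → Option α) (n : ℕ) : (flip bind f)^[n] none = none := by
  induction n with
  | zero => rfl
  | succ n ih => rw [Function.iterate_succ_apply]; exact ih

theorem iterate_bind_succ {n : ℕ} (h : (flip bind f)^[n + 1] (some a) = some b) :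
    ∃ a', f a = some a' ∧ (flip bind f)^[n] (some a') = some b := by
  rw [Function.iterate_succ_apply] at h
  change (flip bind f)^[n] (f a) = some b at h
  cases hfa : f a with
  | none => rw [hfa, iterate_bind_none] at h; simp at h
  | some a' => exact ⟨a', rfl, by rwa [hfa] at h⟩

theorem StepsTo.of_evalsToInTime (h : EvalsToInTime f a (some b) t) : StepsTo f t a b :=
  ⟨h.steps, h.steps_le_m, h.evals_in_steps⟩

theorem StepsTo.nonempty_evalsToInTime (h : StepsTo f t a b) :
    Nonempty (EvalsToInTime f a (some b) t) := by
  obtain ⟨n, hn, h⟩ := h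
  exact ⟨⟨⟨n, h⟩, hn⟩⟩

end StepsTo

/-! ### Running a stack machine inside a larger one -/

section Embed

variable {K K' : Type} {Γ' : K' → Type} {Λ Λ' σ σ' : Type}

/-- A statement of a stack machine, read as a statement of a machine with more stacks, labels and
variables: stack `k` becomes stack `e k`, the label `l` becomes `lab l`, the variables of the small
machine are accessed through `get` and `put`, and halting is replaced by the statement `exit`. -/
def embedStmt (e : K → K') (lab : Λ → Λ') (exit : TM2.Stmt Γ' Λ' σ') (get : σ' → σ)
    (put : σ → σ' → σ') : TM2.Stmt (fun k => Γ' (e k)) Λ σ → TM2.Stmt Γ' Λ' σ'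
  | .push k f q => .push (e k) (fun s => f (get s)) (embedStmt e lab exit get put q)
  | .peek k f q => .peek (e k) (fun s a => put (f (get s) a) s) (embedStmt e lab exit get put q)
  | .pop k f q => .pop (e k) (fun s a => put (f (get s) a) s) (embedStmt e lab exit get put q)
  | .load f q => .load (fun s => put (f (get s)) s) (embedStmt e lab exit get put q)
  | .branch f q₁ q₂ => .branch (fun s => f (get s)) (embedStmt e lab exit get put q₁)
      (embedStmt e lab exit get put q₂)
  | .goto f => .goto (fun s => lab (f (get s)))
  | .halt => exit

variable [DecidableEq K] [DecidableEq K'] {e : K → K'} {lab : Λ → Λ'}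
  {exit : TM2.Stmt Γ' Λ' σ'} {get : σ' → σ} {put : σ → σ' → σ'}

/-- A single step of the small machine. The stacks outside the range of `e` are not touched. -/
theorem stepAux_embedStmt (he : e.Injective) (get_put : ∀ a s, get (put a s) = a)
    (put_put : ∀ a b s, put a (put b s) = put a s) (put_get : ∀ s, put (get s) s = s)
    (q : TM2.Stmt (fun k => Γ' (e k)) Λ σ) (s : σ') (S' : ∀ k', List (Γ' k')) :
    ∃ S'' : ∀ k', List (Γ' k'),
      (∀ k, S'' (e k) = (TM2.stepAux q (get s) (fun k => S' (e k))).stk k) ∧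
      (∀ k', k' ∉ Set.range e → S'' k' = S' k') ∧
      TM2.stepAux (embedStmt e lab exit get put q) s S' =
        (TM2.stepAux q (get s) (fun k => S' (e k))).l.elim
          (TM2.stepAux exit (put (TM2.stepAux q (get s) (fun k => S' (e k))).var s) S'')
          (fun l => ⟨some (lab l),
            put (TM2.stepAux q (get s) (fun k => S' (e k))).var s, S''⟩) := by
  have upd : ∀ (k : K) (x : List (Γ' (e k))) (S' : ∀ k', List (Γ' k')),
      (fun j => Function.update S' (e k) x (e j)) =
        Function.update (fun j => S' (e j)) k x := by
    intro k x S'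
    funext j
    by_cases hj : j = k
    · subst hj; simp
    · rw [Function.update_of_ne hj, Function.update_of_ne (fun h => hj (he h))]
  induction q generalizing s S' with
  | push k f q ih =>
    obtain ⟨S'', h1, h2, h3⟩ := ih s (Function.update S' (e k) (f (get s) :: S' (e k)))
    rw [upd] at h1 h3
    refine ⟨S'', h1, fun k' hk' => ?_, h3⟩
    rw [h2 k' hk', Function.update_of_ne (fun h => hk' ⟨k, h.symm⟩)]
  | peek k f q ih =>
    obtain ⟨S'', h1, h2, h3⟩ := ih (put (f (get s) (S' (e k)).head?) s) S'
    rw [get_put] at h1 h3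
    rw [put_put] at h3
    exact ⟨S'', h1, h2, h3⟩
  | pop k f q ih =>
    obtain ⟨S'', h1, h2, h3⟩ := ih (put (f (get s) (S' (e k)).head?) s)
      (Function.update S' (e k) (S' (e k)).tail)
    rw [upd, get_put] at h1 h3
    rw [put_put] at h3
    refine ⟨S'', h1, fun k' hk' => ?_, h3⟩
    rw [h2 k' hk', Function.update_of_ne (fun h => hk' ⟨k, h.symm⟩)]
  | load f q ih =>
    obtain ⟨S'', h1, h2, h3⟩ := ih (put (f (get s)) s) S'
    rw [get_put] at h1 h3
    rw [put_put] at h3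
    exact ⟨S'', h1, h2, h3⟩
  | branch f q₁ q₂ ih₁ ih₂ =>
    cases hf : f (get s) with
    | true => simpa [embedStmt, TM2.stepAux, hf] using ih₁ s S'
    | false => simpa [embedStmt, TM2.stepAux, hf] using ih₂ s S'
  | goto f => exact ⟨S', fun k => rfl, fun k' _ => rfl, by simp [embedStmt, TM2.stepAux, put_get]⟩
  | halt => exact ⟨S', fun k => rfl, fun k' _ => rfl, by simp [embedStmt, TM2.stepAux, put_get]⟩

/-- A halting run of the small machine is followed step by step by the large machine, which
executes `exit` in the last of these steps. -/
theorem stepsTo_embedStmt (he : e.Injective) (get_put : ∀ a s, get (put a s) = a)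
    (put_put : ∀ a b s, put a (put b s) = put a s) (put_get : ∀ s, put (get s) s = s)
    {M : Λ → TM2.Stmt (fun k => Γ' (e k)) Λ σ} {M' : Λ' → TM2.Stmt Γ' Λ' σ'}
    (hM : ∀ l, M' (lab l) = embedStmt e lab exit get put (M l)) {t : ℕ} {l : Λ} {v : σ}
    {S : ∀ k, List (Γ' (e k))} {v₁ : σ} {S₁ : ∀ k, List (Γ' (e k))}
    (h : StepsTo (TM2.step M) t ⟨some l, v, S⟩ ⟨none, v₁, S₁⟩) {s : σ'} {S' : ∀ k', List (Γ' k')}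
    (hs : get s = v) (hS : ∀ k, S' (e k) = S k) :
    ∃ S'' : ∀ k', List (Γ' k'), (∀ k, S'' (e k) = S₁ k) ∧
      (∀ k', k' ∉ Set.range e → S'' k' = S' k') ∧
      StepsTo (TM2.step M') t ⟨some (lab l), s, S'⟩ (TM2.stepAux exit (put v₁ s) S'') := by
  obtain ⟨n, hn, h⟩ := h
  suffices H : ∃ S'' : ∀ k', List (Γ' k'), (∀ k, S'' (e k) = S₁ k) ∧
      (∀ k', k' ∉ Set.range e → S'' k' = S' k') ∧
      StepsTo (TM2.step M') n ⟨some (lab l), s, S'⟩ (TM2.stepAux exit (put v₁ s) S'') by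
    obtain ⟨S'', h1, h2, h3⟩ := H
    exact ⟨S'', h1, h2, h3.mono hn⟩
  clear hn
  induction n generalizing l v S s S' with
  | zero => simp at h
  | succ n ih =>
    obtain ⟨c, hc, h⟩ := iterate_bind_succ h
    obtain rfl : S = fun k => S' (e k) := funext fun k => (hS k).symm
    subst hs
    rw [TM2.step, Option.some.injEq] at hc
    obtain ⟨S'', h1, h2, h3⟩ := stepAux_embedStmt (lab := lab) (exit := exit) he get_put put_put
      put_get (M l) s S'
    rw [hc] at h1 h3
    have hstep : TM2.step M' ⟨some (lab l), s, S'⟩ = some (c.l.elim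
        (TM2.stepAux exit (put c.var s) S'') (fun l => ⟨some (lab l), put c.var s, S''⟩)) := by
      rw [TM2.step, hM, h3]
    obtain ⟨cl, cv, cS⟩ := c
    cases cl with
    | none =>
      -- A halted machine makes no further step.
      cases n with
      | zero =>
        simp only [Function.iterate_zero, id_eq, Option.some.injEq, TM2.Cfg.mk.injEq,
          true_and] at h
        obtain ⟨rfl, rfl⟩ := h
        exact ⟨S'', h1, h2, (StepsTo.single hstep).mono (by omega)⟩
      | succ n =>
        obtain ⟨c, hc, -⟩ := iterate_bind_succ h
        simp at hc
    | some l' =>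
      obtain ⟨T, t1, t2, t3⟩ := ih (s := put cv s) (S' := S'') (get_put _ _) h1 h
      rw [put_put] at t3
      exact ⟨T, t1, fun k' hk' => (t2 k' hk').trans (h2 k' hk'), StepsTo.head hstep t3⟩

end Embed

/-! ### The length of the output of a stack machine -/

section Size

variable {K : Type} [DecidableEq K] {Γ : K → Type} {Λ σ : Type}

/-- An upper bound for the number of symbols pushed by a statement. -/
def pushCount : TM2.Stmt Γ Λ σ → ℕ
  | .push _ _ q => pushCount q + 1
  | .peek _ _ q => pushCount q
  | .pop _ _ q => pushCount q
  | .load _ q => pushCount q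
  | .branch _ q₁ q₂ => pushCount q₁ + pushCount q₂
  | .goto _ => 0
  | .halt => 0

theorem length_stepAux_le (q : TM2.Stmt Γ Λ σ) (v : σ) (S : ∀ k, List (Γ k)) (k : K) :
    ((TM2.stepAux q v S).stk k).length ≤ (S k).length + pushCount q := by
  induction q generalizing v S with
  | push j f q ih =>
    refine (ih _ _).trans ?_
    by_cases h : k = j
    · subst h
      simp only [pushCount, Function.update_self, List.length_cons]
      omega
    · simp only [pushCount, Function.update_of_ne h]
      omega
  | peek j f q ih => exact ih _ _
  | pop j f q ih =>
    refine (ih _ _).trans ?_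
    by_cases h : k = j
    · subst h; simp [pushCount]
    · simp [pushCount, Function.update_of_ne h]
  | load f q ih => exact ih _ _
  | branch f q₁ q₂ ih₁ ih₂ =>
    cases hf : f v with
    | true => simpa [hf, pushCount] using (ih₁ v S).trans (by omega)
    | false => simpa [hf, pushCount] using (ih₂ v S).trans (by omega)
  | goto f => simp [pushCount]
  | halt => simp [pushCount]

/-- In `t` steps a stack grows by at most `t` times the number of pushes in the program. -/
theorem length_le_of_stepsTo [Fintype Λ] {M : Λ → TM2.Stmt Γ Λ σ} {t : ℕ} {a b : TM2.Cfg Γ Λ σ}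
    (h : StepsTo (TM2.step M) t a b) (k : K) :
    (b.stk k).length ≤ (a.stk k).length + t * ∑ l, pushCount (M l) := by
  obtain ⟨n, hn, h⟩ := h
  refine le_trans ?_ (Nat.add_le_add_left (Nat.mul_le_mul_right _ hn) _)
  clear hn
  induction n generalizing a with
  | zero => simp at h; simp [h]
  | succ n ih =>
    obtain ⟨c, hc, h⟩ := iterate_bind_succ h
    refine (ih h).trans ?_
    obtain ⟨al, av, aS⟩ := a
    cases al with
    | none => simp at hc
    | some l =>
      rw [TM2.step, Option.some.injEq] at hc
      have h1 := length_stepAux_le (M l) av aS k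
      rw [hc] at h1
      have h2 : pushCount (M l) ≤ ∑ l, pushCount (M l) :=
        Finset.single_le_sum (f := fun l => pushCount (M l)) (fun _ _ => Nat.zero_le _)
          (Finset.mem_univ l)
      rw [Nat.succ_mul]
      simp only
      omega

end Size

theorem initList_stk_self (tm : FinTM2) (s : List (tm.Γ tm.k₀)) :
    (initList tm s).stk tm.k₀ = s := by
  simp [initList]

theorem initList_stk_of_ne (tm : FinTM2) (s : List (tm.Γ tm.k₀)) {k : tm.K} (h : k ≠ tm.k₀) :
    (initList tm s).stk k = [] := by
  simp [initList, h]

theorem haltList_stk_self (tm : FinTM2) (s : List (tm.Γ tm.k₁)) :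
    (haltList tm s).stk tm.k₁ = s := by
  simp [haltList]

theorem haltList_stk_of_ne (tm : FinTM2) (s : List (tm.Γ tm.k₁)) {k : tm.K} (h : k ≠ tm.k₁) :
    (haltList tm s).stk k = [] := by
  simp [haltList, h]

theorem monotone_eval_polynomial (p : Polynomial ℕ) : Monotone fun n : ℕ => p.eval n := by
  intro m n h
  simp only [Polynomial.eval_eq_sum]
  exact Finset.sum_le_sum fun i _ => Nat.mul_le_mul_left _ (Nat.pow_le_pow_left h i)

/-! ### Composition of polynomial-time machines -/

section Step

variable {K : Type} [DecidableEq K] {Γ : K → Type} {Λ σ : Type} {M : Λ → TM2.Stmt Γ Λ σ}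
  {l l' : Λ} {k : K} {v w : σ} {S S' : ∀ k, List (Γ k)} {x : List (Γ k)}

theorem step_pop_goto {f : σ → Option (Γ k) → σ} {g : σ → Λ} (hM : M l = .pop k f (.goto g))
    (hx : S k = x) (hw : f v x.head? = w) (hl : g w = l')
    (hS : Function.update S k x.tail = S') :
    TM2.step M ⟨some l, v, S⟩ = some ⟨some l', w, S'⟩ := by
  subst hx hw hl hS
  simp [hM]

theorem step_push_goto {f : σ → Γ k} {g : σ → Λ} (hM : M l = .push k f (.goto g))
    (hx : S k = x) (hl : g v = l') (hS : Function.update S k (f v :: x) = S') :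
    TM2.step M ⟨some l, v, S⟩ = some ⟨some l', v, S'⟩ := by
  subst hx hl hS
  simp [hM]

end Step

section Comp

variable (A B : FinTM2) (φ : A.Γ A.k₁ ≃ B.Γ B.k₀)

/-- The alphabets of the stacks of the composite machine: those of the two machines, and an
auxiliary stack with the input alphabet of the second. -/
abbrev compΓ : A.K ⊕ Option B.K → Type
  | .inl k => A.Γ k
  | .inr none => B.Γ B.k₀
  | .inr (some k) => B.Γ k

/-- The labels of the composite machine. Between the labels of the two machines, a label
`(b, none)` reads a symbol (from the output stack of the first machine if `b = false`, from the
auxiliary stack if `b = true`), and `(b, some g)` pushes the symbol `g` that was read. -/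
abbrev CompΛ : Type :=
  A.Λ ⊕ ((Bool × Option (B.Γ B.k₀)) ⊕ B.Λ)

/-- The variables of the composite machine: those of the two machines, and the last symbol
transferred. -/
abbrev CompVar : Type :=
  A.σ × Option (B.Γ B.k₀) × B.σ

/-- The programs of the composite machine for the transfer of the output of the first machine to
the input stack of the second. The symbols pass through an auxiliary stack, which keeps their
order. -/
def transferStmt : Bool × Option (B.Γ B.k₀) → TM2.Stmt (compΓ A B) (CompΛ A B) (CompVar A B)
  | (false, none) => .pop (.inl A.k₁) (fun s a => (s.1, Option.map φ a, s.2.2))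
      (.goto fun s => .inr (.inl (match s.2.1 with
        | none => (true, none)
        | some g => (false, some g))))
  | (false, some g) => .push (.inr none) (fun _ => g) (.goto fun _ => .inr (.inl (false, none)))
  | (true, none) => .pop (.inr none) (fun s a => (s.1, a, s.2.2))
      (.goto fun s => match s.2.1 with
        | none => .inr (.inr B.main)
        | some g => .inr (.inl (true, some g)))
  | (true, some g) => .push (.inr (some B.k₀)) (fun _ => g)
      (.goto fun _ => .inr (.inl (true, none)))

/-- The program of the composite machine. -/
def compProgram : CompΛ A B → TM2.Stmt (compΓ A B) (CompΛ A B) (CompVar A B)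
  | .inl l => embedStmt (Γ' := compΓ A B) Sum.inl Sum.inl
      (.goto fun _ => .inr (.inl (false, none))) Prod.fst (fun a s => (a, s.2)) (A.m l)
  | .inr (.inl b) => transferStmt A B φ b
  | .inr (.inr l) => embedStmt (Γ' := compΓ A B) (fun k => Sum.inr (some k))
      (fun l => .inr (.inr l)) .halt (fun s => s.2.2) (fun a s => (s.1, s.2.1, a)) (B.m l)

/-- The machine that runs `A`, transfers its output to the input stack of `B`, and runs `B`. -/
def compMachine : FinTM2 :=
  letI := A.kFin
  letI := B.kFin
  letI := A.ΛFin
  letI := B.ΛFin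
  letI := A.σFin
  letI := B.σFin
  letI := B.Γk₀Fin
  letI : Fintype (compΓ A B (.inl A.k₀)) := A.Γk₀Fin
  { K := A.K ⊕ Option B.K
    k₀ := .inl A.k₀
    k₁ := .inr (some B.k₁)
    Γ := compΓ A B
    Λ := CompΛ A B
    main := .inl A.main
    σ := CompVar A B
    initialState := (A.initialState, none, B.initialState)
    m := compProgram A B φ }

/-- The stacks of the composite machine during the transfer. -/
def transferStk (x : List (A.Γ A.k₁)) (y z : List (B.Γ B.k₀)) : ∀ k, List (compΓ A B k)
  | .inl k => Function.update (fun _ => []) A.k₁ x k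
  | .inr none => y
  | .inr (some k) => Function.update (fun _ => []) B.k₀ z k

theorem transferStk_inl_self (x : List (A.Γ A.k₁)) (y z : List (B.Γ B.k₀)) :
    transferStk A B x y z (.inl A.k₁) = x := by
  simp [transferStk]

theorem transferStk_inr_self (x : List (A.Γ A.k₁)) (y z : List (B.Γ B.k₀)) :
    transferStk A B x y z (.inr (some B.k₀)) = z := by
  simp [transferStk]

theorem transferStk_inl_of_ne (x : List (A.Γ A.k₁)) (y z : List (B.Γ B.k₀)) {k : A.K}
    (h : k ≠ A.k₁) : transferStk A B x y z (.inl k) = [] := by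
  simp [transferStk, h]

theorem transferStk_inr_of_ne (x : List (A.Γ A.k₁)) (y z : List (B.Γ B.k₀)) {k : B.K}
    (h : k ≠ B.k₀) : transferStk A B x y z (.inr (some k)) = [] := by
  simp [transferStk, h]

theorem transferStk_nil (k : A.K ⊕ Option B.K) : transferStk A B [] [] [] k = [] := by
  rcases k with k | _ | k
  · by_cases h : k = A.k₁
    · subst h; exact transferStk_inl_self ..
    · exact transferStk_inl_of_ne _ _ _ _ _ h
  · rfl
  · by_cases h : k = B.k₀
    · subst h; exact transferStk_inr_self ..
    · exact transferStk_inr_of_ne _ _ _ _ _ h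

theorem update_transferStk_inl (x x' : List (A.Γ A.k₁)) (y z : List (B.Γ B.k₀)) :
    Function.update (transferStk A B x y z) (.inl A.k₁) x' = transferStk A B x' y z := by
  refine Function.update_eq_iff.2 ⟨(transferStk_inl_self ..).symm, ?_⟩
  rintro (k | _ | k) hk
  · have hk : k ≠ A.k₁ := fun h => hk (by rw [h])
    rw [transferStk_inl_of_ne _ _ _ _ _ hk, transferStk_inl_of_ne _ _ _ _ _ hk]
  · rfl
  · rfl

theorem update_transferStk_none (x : List (A.Γ A.k₁)) (y y' z : List (B.Γ B.k₀)) :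
    Function.update (transferStk A B x y z) (.inr none) y' = transferStk A B x y' z := by
  refine Function.update_eq_iff.2 ⟨rfl, ?_⟩
  rintro (k | _ | k) hk
  · rfl
  · exact absurd rfl hk
  · rfl

theorem update_transferStk_inr (x : List (A.Γ A.k₁)) (y z z' : List (B.Γ B.k₀)) :
    Function.update (transferStk A B x y z) (.inr (some B.k₀)) z' = transferStk A B x y z' := by
  refine Function.update_eq_iff.2 ⟨(transferStk_inr_self ..).symm, ?_⟩
  rintro (k | _ | k) hk
  · rfl
  · rfl
  · have hk : k ≠ B.k₀ := fun h => hk (by rw [h])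
    rw [transferStk_inr_of_ne _ _ _ _ _ hk, transferStk_inr_of_ne _ _ _ _ _ hk]

theorem stepsTo_transfer_first (v : A.σ) (w : B.σ) (g : Option (B.Γ B.k₀))
    (x : List (A.Γ A.k₁)) (y : List (B.Γ B.k₀)) :
    StepsTo (TM2.step (compProgram A B φ)) (2 * x.length + 1)
      ⟨some (.inr (.inl (false, none))), (v, g, w), transferStk A B x y []⟩
      ⟨some (.inr (.inl (true, none))), (v, none, w),
        transferStk A B [] ((x.map φ).reverse ++ y) []⟩ := by
  induction x generalizing g y with
  | nil =>
    refine StepsTo.single ?_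
    exact step_pop_goto rfl (transferStk_inl_self ..) rfl rfl (update_transferStk_inl ..)
  | cons a x ih =>
    have h1 : TM2.step (compProgram A B φ)
        ⟨some (.inr (.inl (false, none))), (v, g, w), transferStk A B (a :: x) y []⟩ =
        some ⟨some (.inr (.inl (false, some (φ a)))), (v, some (φ a), w),
          transferStk A B x y []⟩ := by
      exact step_pop_goto rfl (transferStk_inl_self ..) rfl rfl (update_transferStk_inl ..)
    have h2 : TM2.step (compProgram A B φ)
        ⟨some (.inr (.inl (false, some (φ a)))), (v, some (φ a), w), transferStk A B x y []⟩ =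
        some ⟨some (.inr (.inl (false, none))), (v, some (φ a), w),
          transferStk A B x (φ a :: y) []⟩ := by
      exact step_push_goto rfl rfl rfl (update_transferStk_none ..)
    have := StepsTo.head h1 (StepsTo.head h2 (ih (some (φ a)) (φ a :: y)))
    simp only [List.map_cons, List.reverse_cons, List.append_assoc, List.cons_append,
      List.nil_append, List.length_cons]
    exact this.mono (by omega)

theorem stepsTo_transfer_second (v : A.σ) (w : B.σ) (g : Option (B.Γ B.k₀))
    (y z : List (B.Γ B.k₀)) :
    StepsTo (TM2.step (compProgram A B φ)) (2 * y.length + 1)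
      ⟨some (.inr (.inl (true, none))), (v, g, w), transferStk A B [] y z⟩
      ⟨some (.inr (.inr B.main)), (v, none, w), transferStk A B [] [] (y.reverse ++ z)⟩ := by
  induction y generalizing g z with
  | nil =>
    refine StepsTo.single ?_
    exact step_pop_goto rfl rfl rfl rfl (update_transferStk_none ..)
  | cons a y ih =>
    have h1 : TM2.step (compProgram A B φ)
        ⟨some (.inr (.inl (true, none))), (v, g, w), transferStk A B [] (a :: y) z⟩ =
        some ⟨some (.inr (.inl (true, some a))), (v, some a, w), transferStk A B [] y z⟩ := by
      exact step_pop_goto rfl rfl rfl rfl (update_transferStk_none ..)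
    have h2 : TM2.step (compProgram A B φ)
        ⟨some (.inr (.inl (true, some a))), (v, some a, w), transferStk A B [] y z⟩ =
        some ⟨some (.inr (.inl (true, none))), (v, some a, w),
          transferStk A B [] y (a :: z)⟩ := by
      exact step_push_goto rfl (transferStk_inr_self ..) rfl (update_transferStk_inr ..)
    have := StepsTo.head h1 (StepsTo.head h2 (ih (some a) (a :: z)))
    simp only [List.reverse_cons, List.append_assoc, List.cons_append,
      List.nil_append, List.length_cons]
    exact this.mono (by omega)

theorem stepsTo_compMachine {s t : ℕ} {x : List (A.Γ A.k₀)} {y : List (A.Γ A.k₁)}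
    {z : List (B.Γ B.k₁)} (hA : StepsTo A.step s (initList A x) (haltList A y))
    (hB : StepsTo B.step t (initList B (y.map φ)) (haltList B z)) :
    StepsTo (compMachine A B φ).step (s + (4 * y.length + 2) + t)
      (initList (compMachine A B φ) x) (haltList (compMachine A B φ) z) := by
  have hA' : StepsTo (TM2.step A.m) s ⟨some A.main, A.initialState, (initList A x).stk⟩
      ⟨none, A.initialState, (haltList A y).stk⟩ := hA
  have hB' : StepsTo (TM2.step B.m) t
      ⟨some B.main, B.initialState, (initList B (y.map φ)).stk⟩
      ⟨none, B.initialState, (haltList B z).stk⟩ := hB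
  obtain ⟨S, hS1, hS2, hS3⟩ := stepsTo_embedStmt (Γ' := compΓ A B) (e := Sum.inl)
    (lab := (Sum.inl : A.Λ → CompΛ A B))
    (exit := .goto fun _ => .inr (.inl (false, none))) (get := Prod.fst)
    (put := fun a s => (a, s.2)) Sum.inl_injective (fun _ _ => rfl) (fun _ _ _ => rfl)
    (fun _ => rfl) (M' := compProgram A B φ) (fun _ => rfl) hA'
    (s := (A.initialState, none, B.initialState))
    (S' := (initList (compMachine A B φ) x).stk) rfl (fun k => by
      by_cases h : k = A.k₀
      · subst h
        exact (initList_stk_self (compMachine A B φ) x).trans (initList_stk_self A x).symm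
      · exact (initList_stk_of_ne (compMachine A B φ) x (fun h' => h (Sum.inl_injective h'))).trans
          (initList_stk_of_ne A x h).symm)
  have hS : S = transferStk A B y [] [] := by
    funext k
    rcases k with k | k
    · rw [hS1]
      by_cases h : k = A.k₁
      · subst h; rw [haltList_stk_self, transferStk_inl_self]
      · rw [haltList_stk_of_ne A y h, transferStk_inl_of_ne _ _ _ _ _ h]
    · rw [hS2 _ (by simp)]
      refine (initList_stk_of_ne (compMachine A B φ) x (fun h => Sum.inr_ne_inl h)).trans ?_
      rcases k with _ | k
      · rfl
      · exact (transferStk_nil A B (.inr (some k))).symm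
  obtain ⟨T, hT1, hT2, hT3⟩ := stepsTo_embedStmt (Γ' := compΓ A B)
    (e := fun k => Sum.inr (some k)) (lab := (fun l => .inr (.inr l) : B.Λ → CompΛ A B))
    (exit := .halt) (get := fun s => s.2.2)
    (put := fun a s => (s.1, s.2.1, a)) (fun a b h => by simpa using h) (fun _ _ => rfl)
    (fun _ _ _ => rfl)
    (fun _ => rfl) (M' := compProgram A B φ) (fun _ => rfl) hB'
    (s := (A.initialState, none, B.initialState))
    (S' := transferStk A B [] [] (y.map φ)) rfl (fun k => by
      by_cases h : k = B.k₀
      · subst h; rw [initList_stk_self, transferStk_inr_self]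
      · rw [initList_stk_of_ne B _ h, transferStk_inr_of_ne _ _ _ _ _ h])
  have hT : T = (haltList (compMachine A B φ) z).stk := by
    funext k
    by_cases hk : k ∈ Set.range (fun k : B.K => (Sum.inr (some k) : A.K ⊕ Option B.K))
    · obtain ⟨k, rfl⟩ := hk
      rw [hT1]
      by_cases h : k = B.k₁
      · subst h
        exact (haltList_stk_self B z).trans (haltList_stk_self (compMachine A B φ) z).symm
      · exact (haltList_stk_of_ne B z h).trans (haltList_stk_of_ne (compMachine A B φ) z
          (fun h' => h (Option.some_injective _ (Sum.inr_injective h')))).symm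
    · rw [hT2 _ hk]
      refine Eq.trans ?_ (haltList_stk_of_ne (compMachine A B φ) z
        (fun h => hk ⟨B.k₁, h.symm⟩)).symm
      rcases k with k | _ | k
      · exact transferStk_nil A B (.inl k)
      · rfl
      · exact absurd ⟨k, rfl⟩ hk
  subst hS
  have h1 := stepsTo_transfer_first A B φ A.initialState B.initialState none y []
  have h2 := stepsTo_transfer_second A B φ A.initialState B.initialState none
    (y.map φ).reverse []
  simp only [List.append_nil, List.reverse_reverse, List.length_reverse, List.length_map] at h1 h2
  have h3 := (hS3.trans (h1.trans h2)).trans hT3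
  rw [hT] at h3
  exact h3.mono (by omega)

/-- Polynomial-time computable functions compose. The output of the first machine is bounded by its
running time, as a statement pushes a bounded number of symbols. -/
theorem nonempty_computableInPolyTime_comp {α β γ αΓ βΓ γΓ : Type} {eα : α → List αΓ}
    {eβ : β → List βΓ} {eγ : γ → List γΓ} {f : α → β} {g : β → γ}
    (h₁ : TM2ComputableInPolyTime eα eβ f) (h₂ : TM2ComputableInPolyTime eβ eγ g) :
    Nonempty (TM2ComputableInPolyTime eα eγ (g ∘ f)) := by
  let A := h₁.tm
  let B := h₂.tm
  let φ : A.Γ A.k₁ ≃ B.Γ B.k₀ := h₁.outputAlphabet.trans h₂.inputAlphabet.symm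
  let _ := A.ΛFin
  let C := ∑ l, pushCount (A.m l)
  let len : Polynomial ℕ := Polynomial.X + h₁.time * Polynomial.C C
  have key : ∀ a, StepsTo (compMachine A B φ).step
      ((h₁.time + (4 * len + 2) + h₂.time.comp len).eval (eα a).length)
      (initList (compMachine A B φ) ((eα a).map h₁.inputAlphabet.invFun))
      (haltList (compMachine A B φ) ((eγ (g (f a))).map h₂.outputAlphabet.invFun)) := by
    intro a
    have hA := StepsTo.of_evalsToInTime (h₁.outputsFun a)
    have hB := StepsTo.of_evalsToInTime (h₂.outputsFun (f a))
    have hlen : (eβ (f a)).length ≤ len.eval (eα a).length := by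
      have h := length_le_of_stepsTo (M := A.m) hA A.k₁
      have h1 : ((haltList A ((eβ (f a)).map h₁.outputAlphabet.invFun)).stk A.k₁).length =
          (eβ (f a)).length := by
        rw [haltList_stk_self, List.length_map]
      have h2 : ((initList A ((eα a).map h₁.inputAlphabet.invFun)).stk A.k₁).length ≤
          (eα a).length := by
        by_cases hk : A.k₁ = A.k₀
        · have : ∀ k (_ : k = A.k₀) (x : List (A.Γ A.k₀)),
              ((initList A x).stk k).length = x.length := by
            rintro k rfl x
            rw [initList_stk_self]
          rw [this _ hk, List.length_map]
        · rw [initList_stk_of_ne A _ hk]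
          exact Nat.zero_le _
      have h3 : len.eval (eα a).length =
          (eα a).length + h₁.time.eval (eα a).length * C := by simp [len]
      rw [h3]
      calc (eβ (f a)).length = _ := h1.symm
        _ ≤ _ := h
        _ ≤ _ := Nat.add_le_add_right h2 _
    have hmap : ((eβ (f a)).map h₁.outputAlphabet.invFun).map φ =
        (eβ (f a)).map h₂.inputAlphabet.invFun := by
      rw [List.map_map]
      refine List.map_congr_left fun x _ => ?_
      simp [φ]
    rw [← hmap] at hB
    refine (stepsTo_compMachine A B φ hA hB).mono ?_
    have := monotone_eval_polynomial h₂.time hlen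
    simp only [List.length_map, Polynomial.eval_add, Polynomial.eval_mul, Polynomial.eval_comp,
      Polynomial.eval_ofNat] at this ⊢
    omega
  exact ⟨{
    tm := compMachine A B φ
    inputAlphabet := h₁.inputAlphabet
    outputAlphabet := h₂.outputAlphabet
    time := h₁.time + (4 * len + 2) + h₂.time.comp len
    outputsFun := fun a => (key a).nonempty_evalsToInTime.some }⟩

end Comp

end Complexity

/-! ### Replacing the edges of a board by gadgets -/

namespace DistanceGame

/-- A vertex of a gadget that is to replace an edge `(u, v)`: one of the end points of the edge, or
the new vertex number `a`. -/
inductive Ref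
  | fst
  | snd
  | new (a : ℕ)
  deriving DecidableEq

/-- The vertex number that a reference stands for, if the gadget replaces the edge `e` and its new
vertices are numbered from `base` on. -/
def Ref.eval (base : ℕ) (e : ℕ × ℕ) : Ref → ℕ
  | .fst => e.1
  | .snd => e.2
  | .new a => base + a

/-- The edges of the gadget `E` put in place of the edge `e`. -/
def gadgetEdges (E : List (Ref × Ref)) (base : ℕ) (e : ℕ × ℕ) : List (ℕ × ℕ) :=
  E.map fun r => (r.1.eval base e, r.2.eval base e)

/-- Every edge of the list is replaced by a copy of the gadget `E`, each with `c` new vertices; these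
are numbered from `base` on. The copies are listed in reverse order. -/
def replaceEdges (E : List (Ref × Ref)) (c : ℕ) : ℕ → List (ℕ × ℕ) → List (ℕ × ℕ)
  | _, [] => []
  | base, e :: l => replaceEdges E c (base + c) l ++ gadgetEdges E base e

/-- The contents of the vertices after `m` edges have been replaced by gadgets with contents `P`. -/
def replaceCells (P : List (Option Player)) (cells : List (Option Player)) (m : ℕ) :
    List (Option Player) :=
  cells ++ (List.replicate m P).flatten

/-! ### A machine that replaces edges by gadgets -/

open Turing Complexity

/-- The stacks of the replacement machine: the input, the contents of the vertices so far, counters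
for the two end points of the current edge and for the number of vertices so far, an auxiliary
counter for copying, and the output. -/
inductive Stk
  | inp
  | cells
  | fst
  | snd
  | base
  | tmp
  | out
  deriving DecidableEq

instance : Fintype Stk :=
  ⟨{.inp, .cells, .fst, .snd, .base, .tmp, .out}, fun k => by cases k <;> simp⟩

/-- The labels of the replacement machine, for a gadget that takes `n` vertex references to write
down. -/
inductive Label (n : ℕ)
  /-- read the input up to the next comma: the contents of vertices, or the first end point of an
  edge -/
  | readFst
  /-- read the input up to the next semicolon -/
  | readSnd
  /-- the references from the `i`-th on have been written -/
  | write (i : Fin (n + 1))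
  /-- copy the counter for the `i`-th reference to the output and to the auxiliary counter -/
  | copy (i : Fin n)
  /-- restore the counter for the `i`-th reference -/
  | restore (i : Fin n)
  /-- empty the counter of the first end point -/
  | clearFst
  /-- empty the counter of the second end point, then add the new vertices -/
  | clearSnd
  /-- put the contents of the vertices in front of the output -/
  | flush
  /-- empty the counter of the number of vertices, then halt -/
  | clearBase
  deriving Fintype

/-- The stack on which the main part of the number of a reference is found. -/
def Ref.stk : Ref → Stk
  | .fst => .fst
  | .snd => .snd
  | .new _ => .base

/-- The constant part of the number of a reference. -/
def Ref.offset : Ref → ℕ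
  | .fst => 0
  | .snd => 0
  | .new a => a

/-- The references that occur in the encoding of the edges of a gadget, each with the separator that
follows it. -/
def refs (E : List (Ref × Ref)) : List (Ref × Sym) :=
  E.flatMap fun r => [(r.1, .comma), (r.2, .semicolon)]

/-- Statements of the replacement machine. Its variable holds the symbol read last. -/
abbrev ReplaceStmt (n : ℕ) : Type :=
  TM2.Stmt (fun _ : Stk => Sym) (Label n) (Option Sym)

/-- Put the word `w` on top of the stack `k`. -/
def pushWord {n : ℕ} (k : Stk) : List Sym → ReplaceStmt n → ReplaceStmt n
  | [], q => q
  | a :: w, q => pushWord k w (.push k (fun _ => a) q)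

/-- Reset the variable and jump to the label `l`. -/
def jump {n : ℕ} (l : Label n) : ReplaceStmt n :=
  .load (fun _ => none) (.goto fun _ => l)

/-- Pop a symbol from the stack `k`; execute `q` if the stack was empty, and `q'` otherwise. -/
def popCase {n : ℕ} (k : Stk) (q q' : ReplaceStmt n) : ReplaceStmt n :=
  .pop k (fun _ a => a) (.branch (fun s => s.isNone) q q')

/-- The program of the replacement machine, for a gadget with the contents `P` and the references
`R`. As the output is a stack, the references are written from the last one to the first, each after
the separator that follows it; the vertices' contents, which come first in the output, are collected
on a stack of their own until the input is used up. (The default symbol of `getD` is never pushed,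
and the end of the input is never met in the label `readSnd`.) -/
def replaceProgram (P : List (Option Player)) (R : List (Ref × Sym)) :
    Label R.length → ReplaceStmt R.length
  | .readFst => popCase .inp (jump .flush)
      (.branch (fun s => s == some .tick)
        (.push .fst (fun _ => .tick) (jump .readFst))
        (.branch (fun s => s == some .comma) (jump .readSnd)
          (.push .cells (fun s => s.getD .tick) (.push .base (fun _ => .tick) (jump .readFst)))))
  | .readSnd => popCase .inp (jump .flush)
      (.branch (fun s => s == some .tick)
        (.push .snd (fun _ => .tick) (jump .readSnd)) (jump (.write (Fin.last _))))
  | .write ⟨0, _⟩ => jump .clearFst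
  | .write ⟨i + 1, h⟩ =>
      let r := R[i]
      .push .out (fun _ => r.2) (pushWord .out (List.replicate r.1.offset .tick)
        (jump (.copy ⟨i, Nat.lt_of_succ_lt_succ h⟩)))
  | .copy i => popCase R[i].1.stk (jump (.restore i))
      (.push .out (fun _ => .tick) (.push .tmp (fun _ => .tick) (jump (.copy i))))
  | .restore i => popCase .tmp (jump (.write i.castSucc))
      (.push R[i].1.stk (fun _ => .tick) (jump (.restore i)))
  | .clearFst => popCase .fst (jump .clearSnd) (jump .clearFst)
  | .clearSnd => popCase .snd
      (pushWord .cells (P.map Sym.cell).reverse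
        (pushWord .base (List.replicate P.length .tick) (jump .readFst)))
      (jump .clearSnd)
  | .flush => popCase .cells (jump .clearBase)
      (.push .out (fun s => s.getD .tick) (jump .flush))
  | .clearBase => popCase .base (.load (fun _ => none) .halt) (jump .clearBase)

/-- The machine that replaces the edges of a board by copies of a gadget. -/
def replaceMachine (P : List (Option Player)) (R : List (Ref × Sym)) : FinTM2 where
  K := Stk
  k₀ := .inp
  k₁ := .out
  Γ := fun _ => Sym
  Λ := Label R.length
  main := .readFst
  σ := Option Sym
  initialState := none
  Γk₀Fin := inferInstanceAs (Fintype Sym)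
  m := replaceProgram P R

/-- The stacks of the replacement machine, with counters given as numbers. -/
def stks (inp cells : List Sym) (u v b t : ℕ) (out : List Sym) : Stk → List Sym
  | .inp => inp
  | .cells => cells
  | .fst => List.replicate u .tick
  | .snd => List.replicate v .tick
  | .base => List.replicate b .tick
  | .tmp => List.replicate t .tick
  | .out => out

theorem stepAux_pushWord {n : ℕ} (k : Stk) (w : List Sym) (q : ReplaceStmt n) (s : Option Sym)
    (S : Stk → List Sym) :
    TM2.stepAux (pushWord k w q) s S = TM2.stepAux q s (Function.update S k (w ++ S k)) := by
  induction w generalizing q with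
  | nil => simp [pushWord]
  | cons a w ih => simp [pushWord, ih]

section Run

variable (P : List (Option Player)) (R : List (Ref × Sym))

/-- The configuration of the replacement machine about to execute `l`, with the stacks `S`. -/
abbrev cfg {n : ℕ} (l : Label n) (S : Stk → List Sym) :
    TM2.Cfg (fun _ : Stk => Sym) (Label n) (Option Sym) :=
  ⟨some l, none, S⟩

/-- The replacement machine gets from `a` to `b` in at most `t` steps. -/
abbrev Runs (t : ℕ) (a b : TM2.Cfg (fun _ : Stk => Sym) (Label R.length) (Option Sym)) : Prop :=
  StepsTo (TM2.step (replaceProgram P R)) t a b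

variable {P R}

theorem step_eq {l : Label R.length} {l' : Option (Label R.length)} {S S' : Stk → List Sym}
    (hl : (TM2.stepAux (replaceProgram P R l) none S).l = l')
    (hv : (TM2.stepAux (replaceProgram P R l) none S).var = none)
    (hS : ∀ k, (TM2.stepAux (replaceProgram P R l) none S).stk k = S' k) :
    TM2.step (replaceProgram P R) (cfg l S) = some ⟨l', none, S'⟩ := by
  obtain rfl := funext hS
  subst hl
  rw [TM2.step, Option.some.injEq]
  generalize TM2.stepAux (replaceProgram P R l) none S = c at hv ⊢
  rw [← hv]

theorem runs_clearBase (O : List Sym) (b : ℕ) :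
    Runs P R (b + 1) (cfg .clearBase (stks [] [] 0 0 b 0 O)) ⟨none, none, stks [] [] 0 0 0 0 O⟩ := by
  induction b with
  | zero => exact StepsTo.single (step_eq rfl rfl fun k => by cases k <;> rfl)
  | succ b ih => exact StepsTo.head (step_eq rfl rfl fun k => by cases k <;> rfl) ih

theorem runs_flush (b : ℕ) (C O : List Sym) :
    Runs P R (C.length + 1) (cfg .flush (stks [] C 0 0 b 0 O))
      (cfg .clearBase (stks [] [] 0 0 b 0 (C.reverse ++ O))) := by
  induction C generalizing O with
  | nil =>
    exact StepsTo.single (step_eq rfl rfl fun k => by cases k <;> rfl)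
  | cons a C ih =>
    rw [List.reverse_cons, List.append_assoc]
    exact StepsTo.head (step_eq rfl rfl fun k => by cases k <;> rfl) (ih (a :: O))

theorem runs_readFst_cells (I : List Sym) (b : ℕ) (L : List (Option Player)) (C : List Sym) :
    Runs P R L.length (cfg .readFst (stks (L.map Sym.cell ++ I) C 0 0 b 0 []))
      (cfg .readFst (stks I ((L.map Sym.cell).reverse ++ C) 0 0 (b + L.length) 0 [])) := by
  induction L generalizing b C with
  | nil => exact StepsTo.refl _ _ _
  | cons a L ih =>
    rw [List.map_cons, List.reverse_cons, List.append_assoc, List.length_cons,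
      Nat.add_comm L.length, ← Nat.add_assoc, Nat.add_comm 1]
    exact StepsTo.head (step_eq rfl rfl fun k => by cases k <;> rfl) (ih (b + 1) (Sym.cell a :: C))

theorem runs_readFst_ticks (I C O : List Sym) (u b x : ℕ) :
    Runs P R (x + 1)
      (cfg .readFst (stks (List.replicate x .tick ++ .comma :: I) C u 0 b 0 O))
      (cfg .readSnd (stks I C (u + x) 0 b 0 O)) := by
  induction x generalizing u with
  | zero =>
    exact StepsTo.single (step_eq rfl rfl fun k => by cases k <;> rfl)
  | succ x ih =>
    rw [Nat.add_comm x 1, ← Nat.add_assoc u, Nat.add_comm 1 x]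
    exact StepsTo.head (step_eq rfl rfl fun k => by cases k <;> rfl) (ih (u + 1))

theorem runs_readSnd (I C O : List Sym) (u v b x : ℕ) :
    Runs P R (x + 1)
      (cfg .readSnd (stks (List.replicate x .tick ++ .semicolon :: I) C u v b 0 O))
      (cfg (.write (Fin.last _)) (stks I C u (v + x) b 0 O)) := by
  induction x generalizing v with
  | zero =>
    exact StepsTo.single (step_eq rfl rfl fun k => by cases k <;> rfl)
  | succ x ih =>
    rw [Nat.add_comm x 1, ← Nat.add_assoc v, Nat.add_comm 1 x]
    exact StepsTo.head (step_eq rfl rfl fun k => by cases k <;> rfl) (ih (v + 1))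

theorem runs_clearFst (I C O : List Sym) (u v b : ℕ) :
    Runs P R (u + 1) (cfg .clearFst (stks I C u v b 0 O))
      (cfg .clearSnd (stks I C 0 v b 0 O)) := by
  induction u with
  | zero =>
    exact StepsTo.single (step_eq rfl rfl fun k => by cases k <;> rfl)
  | succ u ih =>
    exact StepsTo.head (step_eq rfl rfl fun k => by cases k <;> rfl) ih

theorem runs_clearSnd (I C O : List Sym) (v b : ℕ) :
    Runs P R (v + 1) (cfg .clearSnd (stks I C 0 v b 0 O))
      (cfg .readFst (stks I ((P.map Sym.cell).reverse ++ C) 0 0 (b + P.length) 0 O)) := by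
  induction v with
  | zero =>
    refine StepsTo.single (congrArg some ?_)
    simp only [replaceProgram, popCase, TM2.stepAux, stks, List.replicate_zero, List.head?_nil,
      Option.isNone_none, cond_true, stepAux_pushWord, jump]
    congr 1
    funext k
    cases k <;> simp [stks, Nat.add_comm b]
  | succ v ih =>
    exact StepsTo.head (step_eq rfl rfl fun k => by cases k <;> rfl) ih

/-- The counter for a reference is emptied onto the output and the auxiliary counter. -/
theorem runs_copy (i : Fin R.length) (x : ℕ) (S : Stk → List Sym)
    (hS : S R[i].1.stk = List.replicate x .tick) :
    Runs P R (x + 1) (cfg (.copy i) S)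
      (cfg (.restore i) (Function.update (Function.update (Function.update S R[i].1.stk [])
        .tmp (List.replicate x .tick ++ S .tmp)) .out (List.replicate x .tick ++ S .out))) := by
  induction x generalizing S with
  | zero =>
    refine StepsTo.single (congrArg some ?_)
    simp only [replaceProgram, popCase, TM2.stepAux, jump, hS, List.replicate_zero,
      List.head?_nil, Option.isNone_none, cond_true, List.tail_nil, List.nil_append]
    congr 1
    funext k
    rcases R[i] with ⟨_ | _ | _, _⟩ <;> cases k <;> rfl
  | succ x ih =>
    refine StepsTo.head ?_ ((congrArg (StepsTo _ _ _) ?_).mp (ih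
      (Function.update (Function.update (Function.update S R[i].1.stk (List.replicate x .tick))
        .tmp (.tick :: S .tmp)) .out (.tick :: S .out)) ?_))
    · refine congrArg some ?_
      simp only [replaceProgram, popCase, TM2.stepAux, jump, hS, List.replicate_succ,
        List.head?_cons, Option.isNone_some, cond_false, List.tail_cons]
      congr 1
      funext k
      rcases R[i] with ⟨_ | _ | _, _⟩ <;> cases k <;> rfl
    · congr 1
      funext k
      rcases R[i] with ⟨_ | _ | _, _⟩ <;> cases k <;> simp [Ref.stk, List.replicate_succ']
    · rcases R[i] with ⟨_ | _ | _, _⟩ <;> rfl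

theorem runs_restore (i : Fin R.length) (x : ℕ) (S : Stk → List Sym)
    (hS : S .tmp = List.replicate x .tick) :
    Runs P R (x + 1) (cfg (.restore i) S)
      (cfg (.write i.castSucc) (Function.update (Function.update S .tmp [])
        R[i].1.stk (List.replicate x .tick ++ S R[i].1.stk))) := by
  induction x generalizing S with
  | zero =>
    refine StepsTo.single (congrArg some ?_)
    simp only [replaceProgram, popCase, TM2.stepAux, jump, hS, List.replicate_zero,
      List.head?_nil, Option.isNone_none, cond_true, List.tail_nil, List.nil_append]
    congr 1
    funext k
    rcases R[i] with ⟨_ | _ | _, _⟩ <;> cases k <;> rfl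
  | succ x ih =>
    refine StepsTo.head ?_ ((congrArg (StepsTo _ _ _) ?_).mp (ih
      (Function.update (Function.update S .tmp (List.replicate x .tick))
        R[i].1.stk (.tick :: S R[i].1.stk)) ?_))
    · refine congrArg some ?_
      simp only [replaceProgram, popCase, TM2.stepAux, jump, hS, List.replicate_succ,
        List.head?_cons, Option.isNone_some, cond_false, List.tail_cons]
      congr 1
      funext k
      rcases R[i] with ⟨_ | _ | _, _⟩ <;> cases k <;> rfl
    · congr 1
      funext k
      rcases R[i] with ⟨_ | _ | _, _⟩ <;> cases k <;> simp [Ref.stk, List.replicate_succ']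
    · rcases R[i] with ⟨_ | _ | _, _⟩ <;> rfl

/-- The word written for a reference. -/
def refWord (base : ℕ) (e : ℕ × ℕ) (r : Ref × Sym) : List Sym :=
  List.replicate (r.1.eval base e) .tick ++ [r.2]

theorem runs_write_succ (i : Fin R.length) (I C O : List Sym) (u v b : ℕ) :
    Runs P R (2 * (u + v + b) + 3) (cfg (.write i.succ) (stks I C u v b 0 O))
      (cfg (.write i.castSucc) (stks I C u v b 0 (refWord b (u, v) R[i] ++ O))) := by
  obtain ⟨x, hx, hxle⟩ : ∃ x, stks I C u v b 0 O R[i].1.stk = List.replicate x .tick ∧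
      x ≤ u + v + b := by
    rcases R[i] with ⟨_ | _ | _, _⟩
    · exact ⟨u, rfl, by omega⟩
    · exact ⟨v, rfl, by omega⟩
    · exact ⟨b, rfl, by omega⟩
  have h1 : TM2.step (replaceProgram P R) (cfg (.write i.succ) (stks I C u v b 0 O)) =
      some (cfg (.copy i) (stks I C u v b 0
        (List.replicate R[i].1.offset .tick ++ R[i].2 :: O))) := by
    obtain ⟨i, hi⟩ := i
    simp only [TM2.step, replaceProgram, TM2.stepAux, jump, Fin.succ_mk, stepAux_pushWord]
    congr 2
    funext k
    cases k <;> simp [stks]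
  have h2 := runs_copy (P := P) i x (stks I C u v b 0
        (List.replicate R[i].1.offset .tick ++ R[i].2 :: O)) (by
    rw [← hx]
    rcases R[i] with ⟨_ | _ | _, _⟩ <;> rfl)
  have h3 := h2.trans (runs_restore (P := P) i x _ (by simp [stks]))
  refine ((congrArg (StepsTo _ _ _) ?_).mp (StepsTo.head h1 h3)).mono (by omega)
  congr 1
  funext k
  clear h1 h2 h3
  generalize R[i] = r at hx ⊢
  rcases r with ⟨_ | _ | a, sep⟩ <;> cases k <;>
    simp_all [stks, Ref.stk, refWord, Ref.eval, Ref.offset]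
  rw [← List.append_assoc, List.replicate_append_replicate]

theorem runs_write (i : Fin (R.length + 1)) (I C O : List Sym) (u v b : ℕ) :
    Runs P R (i * (2 * (u + v + b) + 3)) (cfg (.write i) (stks I C u v b 0 O))
      (cfg (.write 0) (stks I C u v b 0 ((R.take i).flatMap (refWord b (u, v)) ++ O))) := by
  induction i using Fin.induction generalizing O with
  | zero => simpa using StepsTo.refl _ _ _
  | succ i ih =>
    have h := (runs_write_succ (P := P) i I C O u v b).trans (ih _)
    rw [Fin.val_succ, List.take_succ_eq_append_getElem i.isLt, List.flatMap_append,
      List.append_assoc]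
    simp only [List.flatMap_cons, List.flatMap_nil, List.append_nil]
    exact h.mono (le_of_eq (by rw [Fin.val_castSucc]; ring))

/-- The machine reads an edge, writes the edges of a gadget, and adds the gadget's new vertices. -/
theorem runs_edge (I C O : List Sym) (e : ℕ × ℕ) {b N : ℕ} (h₁ : e.1 ≤ N) (h₂ : e.2 ≤ N)
    (hb : b ≤ N) :
    Runs P R (4 * N + 5 + R.length * (6 * N + 3))
      (cfg .readFst (stks (encodeEdge e ++ I) C 0 0 b 0 O))
      (cfg .readFst (stks I ((P.map Sym.cell).reverse ++ C) 0 0 (b + P.length) 0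
        (R.flatMap (refWord b e) ++ O))) := by
  obtain ⟨u, v⟩ := e
  have h1 := runs_readFst_ticks (P := P) (R := R) (List.replicate v .tick ++ .semicolon :: I)
    C O 0 b u
  have h2 := runs_readSnd (P := P) (R := R) I C O (0 + u) 0 b v
  have h3 := runs_write (P := P) (R := R) (Fin.last _) I C O (0 + u) (0 + v) b
  have h4 : TM2.step (replaceProgram P R) (cfg (.write 0) (stks I C (0 + u) (0 + v) b 0
      ((R.take (Fin.last R.length)).flatMap (refWord b (0 + u, 0 + v)) ++ O))) =
      some (cfg .clearFst _) := rfl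
  have h5 := runs_clearFst (P := P) (R := R) I C
    ((R.take (Fin.last R.length)).flatMap (refWord b (0 + u, 0 + v)) ++ O) (0 + u) (0 + v) b
  have h6 := runs_clearSnd (P := P) (R := R) I C
    ((R.take (Fin.last R.length)).flatMap (refWord b (0 + u, 0 + v)) ++ O) (0 + v) b
  have h := h1.trans (h2.trans (h3.trans (StepsTo.head h4 (h5.trans h6))))
  simp only [Nat.zero_add, Fin.val_last, List.take_length] at h
  simp only [encodeEdge, List.append_assoc, List.cons_append, List.nil_append]
  refine h.mono ?_
  have : R.length * (2 * (u + v + b) + 3) ≤ R.length * (6 * N + 3) :=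
    Nat.mul_le_mul_left _ (by simp only at h₁ h₂; omega)
  simp only at h₁ h₂
  omega

theorem flatMap_refWord (E : List (Ref × Ref)) (b : ℕ) (e : ℕ × ℕ) :
    (refs E).flatMap (refWord b e) = (gadgetEdges E b e).flatMap encodeEdge := by
  induction E with
  | nil => rfl
  | cons r E ih =>
    simp only [refs, gadgetEdges, List.flatMap_cons, List.map_cons, List.flatMap_append,
      List.flatMap_nil] at ih ⊢
    rw [ih]
    simp [refWord, encodeEdge]

theorem runs_edges (E : List (Ref × Ref)) (I : List Sym) (l : List (ℕ × ℕ)) (C O : List Sym)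
    {b N : ℕ} (hl : ∀ e ∈ l, e.1 ≤ N ∧ e.2 ≤ N) (hb : b + P.length * l.length ≤ N) :
    Runs P (refs E) (l.length * (4 * N + 5 + (refs E).length * (6 * N + 3)))
      (cfg .readFst (stks (l.flatMap encodeEdge ++ I) C 0 0 b 0 O))
      (cfg .readFst (stks I (((List.replicate l.length P).flatten.map Sym.cell).reverse ++ C) 0 0
        (b + P.length * l.length) 0
        ((replaceEdges E P.length b l).flatMap encodeEdge ++ O))) := by
  generalize hT : 4 * N + 5 + (refs E).length * (6 * N + 3) = T
  induction l generalizing b C O with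
  | nil => simpa [replaceEdges] using StepsTo.refl _ _ _
  | cons e l ih =>
    have he := hl e (by simp)
    rw [List.length_cons, Nat.mul_succ] at hb
    have h1 := runs_edge (P := P) (R := refs E) (l.flatMap encodeEdge ++ I) C O e he.1 he.2
      (b := b) (by omega)
    rw [hT] at h1
    have h2 := ih (C := (P.map Sym.cell).reverse ++ C)
      (O := (refs E).flatMap (refWord b e) ++ O) (fun e he => hl e (by simp [he]))
      (b := b + P.length) (by omega)
    have h := h1.trans h2
    rw [List.length_cons, Nat.succ_mul, Nat.mul_succ, Nat.add_comm (l.length * _),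
      Nat.add_comm (P.length * _), ← Nat.add_assoc b]
    simp only [List.flatMap_cons, List.append_assoc, replaceEdges, List.flatMap_append,
      List.replicate_succ, List.flatten_cons, List.map_append, List.reverse_append,
      flatMap_refWord] at h ⊢
    exact h

end Run

theorem stepsTo_replaceMachine (P : List (Option Player)) (E : List (Ref × Ref)) (b b' : Board)
    (hc : b'.cells = replaceCells P b.cells b.edges.length)
    (he : b'.edges = replaceEdges E P.length b.cells.length b.edges) {N : ℕ}
    (hN : (P.length + 1) * b.encode.length = N) :
    StepsTo (replaceMachine P (refs E)).step
      (b.encode.length * (4 * N + 6 + (refs E).length * (6 * N + 3)) + 2 * N + 3)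
      (initList (replaceMachine P (refs E)) b.encode)
      (haltList (replaceMachine P (refs E)) b'.encode) := by
  -- The encoding of an edge has at least one symbol.
  have hlen : b.cells.length + b.edges.length ≤ b.encode.length := by
    rw [Board.encode, List.length_append, List.length_map, List.length_flatMap]
    refine Nat.add_le_add_left ?_ _
    rw [← Nat.mul_one b.edges.length, ← smul_eq_mul, ← List.length_map (f := fun e =>
      (encodeEdge e).length)]
    refine List.card_nsmul_le_sum _ _ fun x hx => ?_
    obtain ⟨e, -, rfl⟩ := List.mem_map.1 hx
    simp [encodeEdge]
    omega
  have hN' : b.cells.length + P.length * b.edges.length ≤ N := by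
    rw [← hN]
    nlinarith
  have h0 : initList (replaceMachine P (refs E)) b.encode =
      cfg .readFst (stks (b.cells.map Sym.cell ++ b.edges.flatMap encodeEdge) [] 0 0 0 0 []) := by
    refine congrArg (TM2.Cfg.mk _ _) (funext fun k => ?_)
    cases k <;> rfl
  have h6 : haltList (replaceMachine P (refs E)) b'.encode =
      ⟨none, none, stks [] [] 0 0 0 0 b'.encode⟩ := by
    refine congrArg (TM2.Cfg.mk _ _) (funext fun k => ?_)
    cases k <;> rfl
  have h1 := runs_readFst_cells (P := P) (R := refs E) (b.edges.flatMap encodeEdge) 0 b.cells []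
  have h2 := runs_edges (P := P) E [] b.edges ((b.cells.map Sym.cell).reverse ++ []) []
    (b := 0 + b.cells.length) (N := N) (fun e he => by
      have := b.edges_valid e he
      have : 0 ≤ P.length * b.edges.length := Nat.zero_le _
      omega) (by omega)
  have h3 : ∀ (C O : List Sym) (n : ℕ), TM2.step (replaceProgram P (refs E))
      (cfg .readFst (stks [] C 0 0 n 0 O)) = some (cfg .flush (stks [] C 0 0 n 0 O)) :=
    fun C O n => step_eq rfl rfl fun k => by cases k <;> rfl
  have h4 := fun n C O => runs_flush (P := P) (R := refs E) n C O
  have h5 := fun O n => runs_clearBase (P := P) (R := refs E) O n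
  simp only [List.append_nil] at h1 h2
  have h := h1.trans (h2.trans (StepsTo.head (h3 _ _ _) ((h4 _ _ _).trans (h5 _ _))))
  rw [h0, h6]
  have hout : b'.encode = (((List.replicate b.edges.length P).flatten.map Sym.cell).reverse ++
      (b.cells.map Sym.cell).reverse).reverse ++
      (replaceEdges E P.length (0 + b.cells.length) b.edges).flatMap encodeEdge := by
    simp [Board.encode, hc, he, replaceCells]
  rw [hout]
  refine h.mono ?_
  have hC : (((List.replicate b.edges.length P).flatten.map Sym.cell).reverse ++
      (b.cells.map Sym.cell).reverse).length =
      b.cells.length + P.length * b.edges.length := by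
    simp [Nat.mul_comm, Nat.add_comm]
  rw [hC]
  generalize hT : 4 * N + 5 + (refs E).length * (6 * N + 3) = T
  have hT' : 4 * N + 6 + (refs E).length * (6 * N + 3) = T + 1 := by omega
  have h7 : b.edges.length * T ≤ b.encode.length * T := Nat.mul_le_mul_right _ (by omega)
  rw [hT', Nat.mul_succ]
  omega

/-- A map between positions that replaces edges by copies of a gadget is computable in polynomial
time. -/
theorem nonempty_computableInPolyTime_replace {D S D' S' : Set ℕ} (P : List (Option Player))
    (E : List (Ref × Ref)) (f : Position D S → Position D' S')
    (hc : ∀ b, (f b).1.cells = replaceCells P b.1.cells b.1.edges.length)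
    (he : ∀ b, (f b).1.edges = replaceEdges E P.length b.1.cells.length b.1.edges) :
    Nonempty (TM2ComputableInPolyTime (positionEncoding D S).encode
      (positionEncoding D' S').encode f) := by
  let N : Polynomial ℕ := Polynomial.C (P.length + 1) * Polynomial.X
  let time : Polynomial ℕ :=
    Polynomial.X * (4 * N + 6 + Polynomial.C (refs E).length * (6 * N + 3)) + 2 * N + 3
  have key : ∀ b, StepsTo (replaceMachine P (refs E)).step
      (time.eval ((positionEncoding D S).encode b).length)
      (initList (replaceMachine P (refs E))
        (((positionEncoding D S).encode b).map (Equiv.refl Sym).invFun))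
      (haltList (replaceMachine P (refs E))
        (((positionEncoding D' S').encode (f b)).map (Equiv.refl Sym).invFun)) := by
    intro b
    have h := stepsTo_replaceMachine P E b.1 (f b).1 (hc b) (he b) rfl
    refine (congrArg₂ (StepsTo _ _) (congrArg (initList _) (List.map_id _).symm)
      (congrArg (haltList _) (List.map_id _).symm)).mp (h.mono (le_of_eq ?_))
    simp only [time, N, Polynomial.eval_add, Polynomial.eval_mul, Polynomial.eval_X,
      Polynomial.eval_C, Polynomial.eval_ofNat]
    rfl
  exact ⟨{
    tm := replaceMachine P (refs E)
    inputAlphabet := Equiv.refl Sym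
    outputAlphabet := Equiv.refl Sym
    time := time
    outputsFun := fun b => (key b).nonempty_evalsToInTime.some }⟩

end DistanceGame

/-! ### Simulating Col in a distance game -/

namespace DistanceGame

section Transfer

variable {V W : Type}

/-- The vertices of `G` are embedded in `H` by `ι` so that adjacent vertices get distance exactly `k`
and other pairs a larger distance; and the vertices of `H` outside the image of `ι` are unavailable,
because they carry one of the pieces `blk` or are at distance at most `k` from a piece of either
player. These pieces are so far away from the image of `ι` that they do not interfere there, and so
far away from each other that they are legal. -/
structure IsBlockedEmbedding (k : ℕ) (G : SimpleGraph V) (H : SimpleGraph W) (ι : V → W)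
    (blk : W → Option Player) : Prop where
  injective : ι.Injective
  edist_of_adj : ∀ {u v}, G.Adj u v → H.edist (ι u) (ι v) = k
  lt_edist_of_not_adj : ∀ {u v}, u ≠ v → ¬ G.Adj u v → k < H.edist (ι u) (ι v)
  lt_edist_blk : ∀ {u w p}, blk w = some p → k < H.edist (ι u) w
  le_edist_blk : ∀ {w w' p q}, blk w = some p → blk w' = some q → w ≠ w' → k ≤ H.edist w w'
  lt_edist_blk_same : ∀ {w w' p}, blk w = some p → blk w' = some p → w ≠ w' → k < H.edist w w'
  blocked : ∀ {w}, w ∉ Set.range ι → blk w = none →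
    ∀ p, ∃ w', w' ∉ Set.range ι ∧ blk w' = some p ∧ H.edist w w' ≤ k

namespace IsBlockedEmbedding

variable {k : ℕ} {G : SimpleGraph V} {H : SimpleGraph W} {ι : V → W} {blk : W → Option Player}
  {D : Set ℕ}

theorem le_edist (h : IsBlockedEmbedding k G H ι blk) {u v : V} (huv : u ≠ v) :
    k ≤ H.edist (ι u) (ι v) := by
  by_cases hadj : G.Adj u v
  · exact (h.edist_of_adj hadj).ge
  · exact (h.lt_edist_of_not_adj huv hadj).le

/-- A player's pieces at distance `k` exclude each other, but pieces of different players do so only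
at distances below `k`, which do not occur. -/
theorem isLegal_extend_iff (h : IsBlockedEmbedding k G H ι blk) (hk : 1 ≤ k)
    (hD : ∀ d ∈ D, d < k) (c : V → Option Player) :
    IsLegal D (Set.Icc 1 k) H (Function.extend ι c blk) ↔ IsLegal ∅ {1} G c := by
  have ext_of : ∀ v, Function.extend ι c blk (ι v) = c v := h.injective.extend_apply c blk
  constructor
  · intro hl
    refine ⟨fun u v _ _ d hd => absurd hd (Set.notMem_empty d), fun p u v huv hu hv s hs => ?_⟩
    rw [Set.mem_singleton_iff.1 hs, Nat.cast_one, Ne, SimpleGraph.edist_eq_one_iff_adj]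
    intro hadj
    exact hl.2 p (ι u) (ι v) (h.injective.ne huv) ((ext_of u).trans hu) ((ext_of v).trans hv) k
      ⟨hk, le_rfl⟩ (h.edist_of_adj hadj)
  · intro hl
    -- Any two pieces are at distance at least `k`, two pieces of the same player at a larger one.
    have key : ∀ w w' p q, w ≠ w' → Function.extend ι c blk w = some p →
        Function.extend ι c blk w' = some q →
        k ≤ H.edist w w' ∧ (p = q → k < H.edist w w') := by
      intro w w' p q hne hw hw'
      by_cases hr : w ∈ Set.range ι
      · obtain ⟨u, rfl⟩ := hr
        rw [ext_of] at hw
        by_cases hr' : w' ∈ Set.range ι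
        · obtain ⟨v, rfl⟩ := hr'
          rw [ext_of] at hw'
          have huv : u ≠ v := fun huv => hne (by rw [huv])
          refine ⟨h.le_edist huv, ?_⟩
          rintro rfl
          refine h.lt_edist_of_not_adj huv fun hadj => ?_
          exact hl.2 p u v huv hw hw' 1 rfl
            (by rw [Nat.cast_one, SimpleGraph.edist_eq_one_iff_adj]; exact hadj)
        · rw [Function.extend_apply' _ _ _ (by simpa using hr')] at hw'
          exact ⟨(h.lt_edist_blk hw').le, fun _ => h.lt_edist_blk hw'⟩
      · rw [Function.extend_apply' _ _ _ (by simpa using hr)] at hw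
        by_cases hr' : w' ∈ Set.range ι
        · obtain ⟨v, rfl⟩ := hr'
          rw [SimpleGraph.edist_comm]
          exact ⟨(h.lt_edist_blk hw).le, fun _ => h.lt_edist_blk hw⟩
        · rw [Function.extend_apply' _ _ _ (by simpa using hr')] at hw'
          refine ⟨h.le_edist_blk hw hw' hne, ?_⟩
          rintro rfl
          exact h.lt_edist_blk_same hw hw' hne
    refine ⟨fun u v hu hv d hd heq => ?_, fun p u v huv hu hv s hs heq => ?_⟩
    · have hne : u ≠ v := by
        rintro rfl
        rw [hu] at hv
        cases hv
      have := (key u v _ _ hne hu hv).1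
      rw [heq, Nat.cast_le] at this
      exact absurd (hD d hd) (by omega)
    · have := (key u v _ _ huv hu hv).2 rfl
      rw [heq, Nat.cast_lt] at this
      exact absurd hs.2 (by omega)

variable [DecidableEq W]

theorem mem_range_of_canPlace (h : IsBlockedEmbedding k G H ι blk) {p : Player}
    {c : V → Option Player} {w : W}
    (hw : CanPlace D (Set.Icc 1 k) H p (Function.extend ι c blk) w) : w ∈ Set.range ι := by
  by_contra hr
  obtain ⟨hw, hl⟩ := hw
  rw [Function.extend_apply' _ _ _ (by simpa using hr)] at hw
  obtain ⟨w', hr', hw', hle⟩ := h.blocked hr hw p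
  have hne : w ≠ w' := by
    rintro rfl
    rw [hw] at hw'
    cases hw'
  obtain ⟨s, hs⟩ := ENat.ne_top_iff_exists.1 (ne_top_of_le_ne_top (ENat.natCast_ne_top k) hle)
  refine hl.2 p w w' hne (Function.update_self ..) ?_ s ⟨?_, ?_⟩ hs.symm
  · rw [Function.update_of_ne hne.symm, Function.extend_apply' _ _ _ (by simpa using hr'), hw']
  · rw [Nat.one_le_iff_ne_zero]
    rintro rfl
    exact hne (SimpleGraph.edist_eq_zero_iff.1 hs.symm)
  · rw [← hs, Nat.cast_le] at hle
    exact hle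

variable [DecidableEq V]

theorem extend_update (h : IsBlockedEmbedding k G H ι blk) (c : V → Option Player) (v : V)
    (a : Option Player) :
    Function.update (Function.extend ι c blk) (ι v) a =
      Function.extend ι (Function.update c v a) blk := by
  refine Function.update_eq_iff.2 ⟨?_, fun w hw => ?_⟩
  · rw [h.injective.extend_apply, Function.update_self]
  · by_cases hr : w ∈ Set.range ι
    · obtain ⟨u, rfl⟩ := hr
      rw [h.injective.extend_apply, h.injective.extend_apply,
        Function.update_of_ne fun huv => hw (by rw [huv])]
    · rw [Function.extend_apply' _ _ _ (by simpa using hr),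
        Function.extend_apply' _ _ _ (by simpa using hr)]

theorem canPlace_extend_iff (h : IsBlockedEmbedding k G H ι blk) (hk : 1 ≤ k)
    (hD : ∀ d ∈ D, d < k) (p : Player) (c : V → Option Player) (v : V) :
    CanPlace D (Set.Icc 1 k) H p (Function.extend ι c blk) (ι v) ↔ CanPlace ∅ {1} G p c v := by
  rw [CanPlace, CanPlace, h.injective.extend_apply, h.extend_update, h.isLegal_extend_iff hk hD]

/-- The moves of Col on `G` are exactly the moves of the distance game on `H`. -/
theorem winsMovingNext_extend_iff (h : IsBlockedEmbedding k G H ι blk) (hk : 1 ≤ k)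
    (hD : ∀ d ∈ D, d < k) (p : Player) (c : V → Option Player) :
    WinsMovingNext D (Set.Icc 1 k) H p (Function.extend ι c blk) ↔
      WinsMovingNext ∅ {1} G p c := by
  constructor
  · intro hw
    generalize hc : Function.extend ι c blk = c' at hw
    induction hw generalizing c with
    | intro c' v hv _ ih =>
      subst hc
      obtain ⟨v, rfl⟩ := h.mem_range_of_canPlace hv
      refine .intro c v ((h.canPlace_extend_iff hk hD p c v).1 hv) fun w hw => ?_
      rw [← h.canPlace_extend_iff hk hD, ← h.extend_update] at hw
      exact ih (ι w) hw _ (by rw [← h.extend_update, ← h.extend_update])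
  · intro hw
    induction hw with
    | intro c v hv _ ih =>
      refine .intro _ (ι v) ((h.canPlace_extend_iff hk hD p c v).2 hv) fun w hw => ?_
      rw [h.extend_update] at hw
      obtain ⟨w, rfl⟩ := h.mem_range_of_canPlace hw
      rw [h.extend_update, h.extend_update]
      exact ih w ((h.canPlace_extend_iff hk hD _ _ w).1 hw)

end IsBlockedEmbedding

end Transfer

/-! ### Estimates of distances in graphs -/

/-- A function that changes by at most `1` along every edge bounds distances from below. -/
theorem le_edist_of_lipschitz {V : Type*} {G : SimpleGraph V} (f : V → ℤ)
    (hf : ∀ u v, G.Adj u v → |f u - f v| ≤ 1) {u v : V} {d : ℕ} (hd : (d : ℤ) ≤ |f u - f v|) :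
    (d : ℕ∞) ≤ G.edist u v := by
  have key : ∀ {u v : V} (p : G.Walk u v), |f u - f v| ≤ p.length := by
    intro u v p
    induction p with
    | nil => simp
    | @cons u v w huv p ih =>
      have h1 := hf u v huv
      have h2 := abs_sub_le (f u) (f v) (f w)
      rw [SimpleGraph.Walk.length_cons]
      push_cast
      omega
  refine le_iInf fun p => ?_
  have := key p
  exact_mod_cast hd.trans this

theorem Board.adj_iff (b : Board) (x y : Fin b.cells.length) :
    b.graph.Adj x y ↔ ((x : ℕ), (y : ℕ)) ∈ b.edges ∨ ((y : ℕ), (x : ℕ)) ∈ b.edges := by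
  rw [Board.graph, SimpleGraph.fromRel_adj, and_iff_right_iff_imp]
  rintro h rfl
  rcases h with h | h <;> exact (b.edges_valid _ h).2.2 rfl

theorem Board.edist_le_one {b : Board} {x y : Fin b.cells.length}
    (h : ((x : ℕ), (y : ℕ)) ∈ b.edges) : b.graph.edist x y ≤ 1 :=
  (SimpleGraph.edist_eq_one_iff_adj.2 ((b.adj_iff x y).2 (.inl h))).le

theorem Board.edist_le_of_chain {b : Board} {f : ℕ → ℕ} {n : ℕ}
    (hf : ∀ i < n, (f i, f (i + 1)) ∈ b.edges) {i j : ℕ} (hij : i ≤ j) (hj : j ≤ n)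
    {x y : Fin b.cells.length} (hx : (x : ℕ) = f i) (hy : (y : ℕ) = f j) :
    b.graph.edist x y ≤ (j - i : ℕ) := by
  obtain ⟨d, rfl⟩ := Nat.exists_eq_add_of_le hij
  rw [Nat.add_sub_cancel_left]
  clear hij
  induction d generalizing y with
  | zero =>
    obtain rfl : x = y := Fin.ext (hx.trans hy.symm)
    simp
  | succ d ih =>
    have hmem := hf (i + d) (by omega)
    refine (SimpleGraph.edist_triangle (v := ⟨f (i + d), (b.edges_valid _ hmem).1⟩)).trans ?_
    rw [Nat.cast_succ]
    refine add_le_add (ih (by omega) rfl) (Board.edist_le_one ?_)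
    rw [hy]
    exact hmem

/-! ### The gadget -/

/-- The vertex at distance `i` from the first end point of the edge, on the path of length `k` that
replaces it. -/
def pathRef (k i : ℕ) : Ref :=
  if i = 0 then .fst else if i = k then .snd else .new (i - 1)

/-- The vertex number `t` on the second path of the gadget, whose end points carry pieces. -/
def armRef (k t : ℕ) : Ref :=
  .new (k - 1 + t)

/-- The gadget that replaces an edge: a path of length `k` between the end points of the edge, and a
path of length `2 * ⌈k / 2⌉` whose middle vertex is joined to the vertices number `⌊k / 2⌋` and
`⌈k / 2⌉` of the first path. -/
def gadget (k : ℕ) : List (Ref × Ref) :=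
  (List.range k).map (fun i => (pathRef k i, pathRef k (i + 1))) ++
  (List.range (2 * ((k + 1) / 2))).map (fun t => (armRef k t, armRef k (t + 1))) ++
  [(pathRef k (k / 2), armRef k ((k + 1) / 2)), (pathRef k ((k + 1) / 2), armRef k ((k + 1) / 2))]

/-- The number of the vertex of the second path on which `p` has a piece. -/
def armEnd (k : ℕ) : Player → ℕ
  | .left => 0
  | .right => 2 * ((k + 1) / 2)

/-- The contents of the new vertices of the gadget: there are pieces of the two players at the two
ends of the second path. -/
def gadgetCells (k : ℕ) : List (Option Player) :=
  (List.range (k + 2 * ((k + 1) / 2))).map fun a =>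
    if a = k - 1 + armEnd k .left then some .left
    else if a = k - 1 + armEnd k .right then some .right else none

theorem length_gadgetCells (k : ℕ) : (gadgetCells k).length = k + 2 * ((k + 1) / 2) := by
  simp [gadgetCells]

theorem mem_replaceEdges {E : List (Ref × Ref)} {c base : ℕ} {l : List (ℕ × ℕ)} {x : ℕ × ℕ} :
    x ∈ replaceEdges E c base l ↔
      ∃ j < l.length, x ∈ gadgetEdges E (base + c * j) (l.getD j (0, 0)) := by
  induction l generalizing base with
  | nil => simp [replaceEdges]
  | cons e l ih =>
    rw [replaceEdges, List.mem_append, ih]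
    constructor
    · rintro (⟨j, hj, h⟩ | h)
      · exact ⟨j + 1, by simpa using hj, by
          rw [List.getD_cons_succ, Nat.mul_succ, Nat.add_comm (c * j), ← Nat.add_assoc]; exact h⟩
      · exact ⟨0, by simp, by simpa using h⟩
    · rintro ⟨_ | j, hj, h⟩
      · exact .inr (by simpa using h)
      · refine .inl ⟨j, by simpa using hj, ?_⟩
        rw [List.getD_cons_succ, Nat.mul_succ, Nat.add_comm (c * j), ← Nat.add_assoc] at h
        exact h

/-- The `a`-th entry of the `j`-th copy of a list. -/
theorem getElem?_flatten_replicate {α : Type*} (P : List α) {m j a : ℕ} (hj : j < m)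
    (ha : a < P.length) : (List.replicate m P).flatten[P.length * j + a]? = P[a]? := by
  induction m generalizing j with
  | zero => omega
  | succ m ih =>
    rw [List.replicate_succ, List.flatten_cons]
    cases j with
    | zero => rw [Nat.mul_zero, Nat.zero_add, List.getElem?_append_left ha]
    | succ j =>
      rw [List.getElem?_append_right (by rw [Nat.mul_succ]; omega), ← ih (by omega : j < m)]
      congr 1
      rw [Nat.mul_succ]
      omega

section Expand

variable (k : ℕ) (b : Board)

/-- The `j`-th edge of a board, with the value `(0, 0)` if there is no such edge. -/
def Board.edge (j : ℕ) : ℕ × ℕ :=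
  b.edges.getD j (0, 0)

theorem Board.edge_mem {j : ℕ} (hj : j < b.edges.length) : b.edge j ∈ b.edges := by
  rw [Board.edge, List.getD_eq_getElem _ _ hj]
  exact List.getElem_mem hj

theorem Board.exists_edge {e : ℕ × ℕ} (he : e ∈ b.edges) :
    ∃ j < b.edges.length, b.edge j = e := by
  obtain ⟨j, hj, rfl⟩ := List.getElem_of_mem he
  exact ⟨j, hj, List.getD_eq_getElem _ _ hj⟩

/-- The number of the first new vertex of the gadget in place of the `j`-th edge. -/
def gadgetBase (j : ℕ) : ℕ :=
  b.cells.length + (gadgetCells k).length * j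

/-- The vertex number `i` on the path in place of the `j`-th edge. -/
def pathVertex (j i : ℕ) : ℕ :=
  (pathRef k i).eval (gadgetBase k b j) (b.edge j)

/-- The vertex number `t` on the second path of the gadget in place of the `j`-th edge. -/
def armVertex (j t : ℕ) : ℕ :=
  (armRef k t).eval (gadgetBase k b j) (b.edge j)

/-- The edges of the board with gadgets in place of the edges. -/
def expandEdges : List (ℕ × ℕ) :=
  replaceEdges (gadget k) (gadgetCells k).length b.cells.length b.edges

theorem mem_expandEdges {x : ℕ × ℕ} :
    x ∈ expandEdges k b ↔ ∃ j < b.edges.length,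
      (∃ i < k, x = (pathVertex k b j i, pathVertex k b j (i + 1))) ∨
      (∃ t < 2 * ((k + 1) / 2), x = (armVertex k b j t, armVertex k b j (t + 1))) ∨
      x = (pathVertex k b j (k / 2), armVertex k b j ((k + 1) / 2)) ∨
      x = (pathVertex k b j ((k + 1) / 2), armVertex k b j ((k + 1) / 2)) := by
  rw [expandEdges, mem_replaceEdges]
  refine exists_congr fun j => and_congr_right fun _ => ?_
  simp only [gadgetEdges, gadget, List.map_append, List.map_map, List.mem_append, List.mem_map,
    List.mem_range, Function.comp_apply, List.map_cons, List.map_nil, List.mem_cons,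
    List.not_mem_nil, or_false, or_assoc]
  refine or_congr (exists_congr fun i => and_congr_right fun _ => eq_comm) (or_congr
    (exists_congr fun i => and_congr_right fun _ => eq_comm) Iff.rfl)

variable {k b}

theorem pathVertex_zero (j : ℕ) : pathVertex k b j 0 = (b.edge j).1 := by
  simp [pathVertex, pathRef, Ref.eval]

theorem pathVertex_self (hk : 1 ≤ k) (j : ℕ) : pathVertex k b j k = (b.edge j).2 := by
  rw [pathVertex, pathRef, if_neg (by omega), if_pos rfl, Ref.eval]

theorem pathVertex_of_pos {j i : ℕ} (hi : 0 < i) (hik : i < k) :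
    pathVertex k b j i = gadgetBase k b j + (i - 1) := by
  rw [pathVertex, pathRef, if_neg (by omega), if_neg (by omega), Ref.eval]

theorem armVertex_eq (j t : ℕ) : armVertex k b j t = gadgetBase k b j + (k - 1 + t) :=
  rfl

theorem gadgetBase_add_lt {j a : ℕ} (hj : j < b.edges.length) (ha : a < (gadgetCells k).length) :
    gadgetBase k b j + a < b.cells.length + (gadgetCells k).length * b.edges.length := by
  have : (gadgetCells k).length * (j + 1) ≤ (gadgetCells k).length * b.edges.length :=
    Nat.mul_le_mul_left _ hj
  rw [Nat.mul_succ] at this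
  rw [gadgetBase]
  omega

theorem length_replaceCells (P : List (Option Player)) (cells : List (Option Player)) (m : ℕ) :
    (replaceCells P cells m).length = cells.length + P.length * m := by
  simp [replaceCells, Nat.mul_comm]

theorem expandEdges_valid (hk : 1 ≤ k) :
    ∀ e ∈ expandEdges k b,
      e.1 < (replaceCells (gadgetCells k) b.cells b.edges.length).length ∧
      e.2 < (replaceCells (gadgetCells k) b.cells b.edges.length).length ∧ e.1 ≠ e.2 := by
  intro e he
  rw [length_replaceCells]
  obtain ⟨j, hj, he⟩ := (mem_expandEdges k b).1 he
  have hv := b.edges_valid _ (b.edge_mem hj)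
  have hlen := length_gadgetCells k
  have hge : b.cells.length ≤ gadgetBase k b j := Nat.le_add_right _ _
  have h0 : b.cells.length ≤ b.cells.length + (gadgetCells k).length * b.edges.length :=
    Nat.le_add_right _ _
  have hpath : ∀ i ≤ k, (pathVertex k b j i <
      b.cells.length + (gadgetCells k).length * b.edges.length) ∧
      (i = 0 ∧ pathVertex k b j i = (b.edge j).1 ∨ i = k ∧ pathVertex k b j i = (b.edge j).2 ∨
        pathVertex k b j i = gadgetBase k b j + (i - 1) ∧ 0 < i ∧ i < k) := by
    intro i hi
    rcases Nat.eq_zero_or_pos i with rfl | hpos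
    · rw [pathVertex_zero]
      exact ⟨by omega, .inl ⟨rfl, rfl⟩⟩
    · rcases hi.eq_or_lt with rfl | hlt
      · rw [pathVertex_self hk]
        exact ⟨by omega, .inr (.inl ⟨rfl, rfl⟩)⟩
      · rw [pathVertex_of_pos hpos hlt]
        exact ⟨gadgetBase_add_lt hj (by omega), .inr (.inr ⟨rfl, hpos, hlt⟩)⟩
  have harm : ∀ t ≤ 2 * ((k + 1) / 2), armVertex k b j t <
      b.cells.length + (gadgetCells k).length * b.edges.length := by
    intro t ht
    rw [armVertex_eq]
    exact gadgetBase_add_lt hj (by omega)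
  rcases he with ⟨i, hi, rfl⟩ | ⟨t, ht, rfl⟩ | rfl | rfl
  · have h1 := hpath i (by omega)
    have h2 := hpath (i + 1) (by omega)
    refine ⟨h1.1, h2.1, ?_⟩
    simp only
    omega
  · refine ⟨harm t (by omega), harm (t + 1) (by omega), ?_⟩
    simp only [armVertex_eq]
    omega
  · have h1 := hpath (k / 2) (by omega)
    refine ⟨h1.1, harm _ (by omega), ?_⟩
    simp only [armVertex_eq]
    omega
  · have h1 := hpath ((k + 1) / 2) (by omega)
    refine ⟨h1.1, harm _ (by omega), ?_⟩
    simp only [armVertex_eq]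
    omega

/-- The board with gadgets in place of the edges. -/
def expand (hk : 1 ≤ k) (b : Board) : Board where
  cells := replaceCells (gadgetCells k) b.cells b.edges.length
  edges := expandEdges k b
  edges_valid := expandEdges_valid hk

end Expand

end DistanceGame

namespace DistanceGame

/-! ### Distances in the board with gadgets -/

section Distances

variable {k : ℕ} {b : Board}

/-- The function on the vertices of the board with gadgets with the values `f` on the original
vertices, `ξ j i` on the inner vertices of the path in place of the `j`-th edge, and `η j t` on the
second path of its gadget. -/
def potential (k : ℕ) (b : Board) (f : ℕ → ℤ) (ξ η : ℕ → ℕ → ℤ) (w : ℕ) : ℤ :=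
  if w < b.cells.length then f w
  else
    let j := (w - b.cells.length) / (gadgetCells k).length
    let a := (w - b.cells.length) % (gadgetCells k).length
    if a < k - 1 then ξ j (a + 1) else η j (a - (k - 1))

variable {f : ℕ → ℤ} {ξ η : ℕ → ℕ → ℤ}

theorem potential_of_lt {w : ℕ} (hw : w < b.cells.length) : potential k b f ξ η w = f w :=
  if_pos hw

theorem potential_gadgetBase_add {j a : ℕ} (ha : a < (gadgetCells k).length) :
    potential k b f ξ η (gadgetBase k b j + a) =
      if a < k - 1 then ξ j (a + 1) else η j (a - (k - 1)) := by
  have h1 : gadgetBase k b j + a - b.cells.length = (gadgetCells k).length * j + a := by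
    rw [gadgetBase]; omega
  rw [potential, if_neg (by rw [gadgetBase]; omega), h1, Nat.mul_add_div (by omega),
    Nat.div_eq_of_lt ha, Nat.add_zero, Nat.mul_add_mod, Nat.mod_eq_of_lt ha]

theorem potential_armVertex {j t : ℕ} (ht : t ≤ 2 * ((k + 1) / 2)) (hk : 1 ≤ k) :
    potential k b f ξ η (armVertex k b j t) = η j t := by
  have := length_gadgetCells k
  rw [armVertex_eq, potential_gadgetBase_add (by omega), if_neg (by omega),
    Nat.add_sub_cancel_left]

theorem potential_pathVertex {j i : ℕ} (hk : 1 ≤ k) (hj : j < b.edges.length) (hi : i ≤ k)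
    (h0 : ξ j 0 = f (b.edge j).1) (h1 : ξ j k = f (b.edge j).2) :
    potential k b f ξ η (pathVertex k b j i) = ξ j i := by
  have hlen := length_gadgetCells k
  have hv := b.edges_valid _ (b.edge_mem hj)
  rcases Nat.eq_zero_or_pos i with rfl | hpos
  · rw [pathVertex_zero, potential_of_lt hv.1, h0]
  · rcases hi.eq_or_lt with rfl | hlt
    · rw [pathVertex_self hk, potential_of_lt hv.2.1, h1]
    · rw [pathVertex_of_pos hpos hlt, potential_gadgetBase_add (by omega), if_pos (by omega),
        Nat.sub_add_cancel hpos]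

/-- A potential that changes by at most `1` along every edge of every gadget bounds distances from
below. -/
theorem le_edist_of_potential (hk : 1 ≤ k) (f : ℕ → ℤ) (ξ η : ℕ → ℕ → ℤ)
    (h0 : ∀ j < b.edges.length, ξ j 0 = f (b.edge j).1)
    (h1 : ∀ j < b.edges.length, ξ j k = f (b.edge j).2)
    (hξ : ∀ j < b.edges.length, ∀ i < k, |ξ j i - ξ j (i + 1)| ≤ 1)
    (hη : ∀ j < b.edges.length, ∀ t < 2 * ((k + 1) / 2), |η j t - η j (t + 1)| ≤ 1)
    (hlo : ∀ j < b.edges.length, |ξ j (k / 2) - η j ((k + 1) / 2)| ≤ 1)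
    (hhi : ∀ j < b.edges.length, |ξ j ((k + 1) / 2) - η j ((k + 1) / 2)| ≤ 1)
    {x y : Fin (expand hk b).cells.length} {d : ℕ}
    (hd : (d : ℤ) ≤ |potential k b f ξ η x - potential k b f ξ η y|) :
    (d : ℕ∞) ≤ (expand hk b).graph.edist x y := by
  have key : ∀ e ∈ expandEdges k b,
      |potential k b f ξ η e.1 - potential k b f ξ η e.2| ≤ 1 := by
    intro e he
    obtain ⟨j, hj, he⟩ := (mem_expandEdges k b).1 he
    have hp : ∀ i ≤ k, potential k b f ξ η (pathVertex k b j i) = ξ j i := fun i hi =>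
      potential_pathVertex hk hj hi (h0 j hj) (h1 j hj)
    have ha : ∀ t ≤ 2 * ((k + 1) / 2), potential k b f ξ η (armVertex k b j t) = η j t :=
      fun t ht => potential_armVertex ht hk
    rcases he with ⟨i, hi, rfl⟩ | ⟨t, ht, rfl⟩ | rfl | rfl
    · rw [hp _ (by omega), hp _ (by omega)]
      exact hξ j hj i hi
    · rw [ha _ (by omega), ha _ (by omega)]
      exact hη j hj t ht
    · rw [hp _ (by omega), ha _ (by omega)]
      exact hlo j hj
    · rw [hp _ (by omega), ha _ (by omega)]
      exact hhi j hj
  refine le_edist_of_lipschitz (V := Fin (expand hk b).cells.length)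
    (fun x => potential k b f ξ η x) (fun u v huv => ?_) hd
  rcases ((expand hk b).adj_iff u v).1 huv with h | h
  · exact key ((u : ℕ), (v : ℕ)) h
  · rw [abs_sub_comm]
    exact key ((v : ℕ), (u : ℕ)) h

/-- Two numbers are joined by an edge of the board, in either direction. -/
def Board.Joined (b : Board) (u v : ℕ) : Prop :=
  (u, v) ∈ b.edges ∨ (v, u) ∈ b.edges

open Classical in
/-- Lower bounds for the distances from an original vertex `u`: to the other original vertices, and
to the pieces of the gadgets. -/
theorem le_edist_original (hk : 1 ≤ k) {u : ℕ} {x : Fin (expand hk b).cells.length}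
    (hx : (x : ℕ) = u) (hu : u < b.cells.length) :
    (∀ y : Fin (expand hk b).cells.length, (y : ℕ) < b.cells.length → (y : ℕ) ≠ u →
      (k : ℕ∞) ≤ (expand hk b).graph.edist x y ∧
      (¬ b.Joined u y → ((k + 1 : ℕ) : ℕ∞) ≤ (expand hk b).graph.edist x y)) ∧
    ∀ (y : Fin (expand hk b).cells.length) (j : ℕ) (p : Player),
      (y : ℕ) = armVertex k b j (armEnd k p) →
      ((k + 1 : ℕ) : ℕ∞) ≤ (expand hk b).graph.edist x y := by
  -- The distance from `u`, cut off at `k + 1`. In a gadget next to `u`, the middle of the second path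
  -- is at distance `⌊k / 2⌋ + 1` from either end point of the edge, as `k - ⌈k / 2⌉ = ⌊k / 2⌋`.
  let f : ℕ → ℤ := fun w => if w = u then 0 else if b.Joined u w then k else k + 1
  let ξ : ℕ → ℕ → ℤ := fun j i =>
    if (b.edge j).1 = u then i else if (b.edge j).2 = u then k - i
    else if i = 0 then f (b.edge j).1 else if i = k then f (b.edge j).2 else k + 1
  let η : ℕ → ℕ → ℤ := fun j t =>
    if (b.edge j).1 = u ∨ (b.edge j).2 = u then (k / 2 : ℕ) + 1 + |(t : ℤ) - ((k + 1) / 2 : ℕ)|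
    else k + 1
  have hf : ∀ w, w ≠ u → f w = k ∨ f w = k + 1 := by
    intro w hw
    simp only [f, if_neg hw]
    split_ifs <;> simp
  have hfu : f u = 0 := if_pos rfl
  have hfe : ∀ j < b.edges.length, ((b.edge j).1 = u → f (b.edge j).2 = k) ∧
      ((b.edge j).2 = u → f (b.edge j).1 = k) ∧ (b.edge j).1 ≠ (b.edge j).2 := by
    intro j hj
    have hm := b.edge_mem hj
    have hne := (b.edges_valid _ hm).2.2
    refine ⟨fun h => ?_, fun h => ?_, hne⟩
    · have : b.Joined u (b.edge j).2 := .inl (by rw [← h]; exact hm)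
      simp only [f, if_neg (h ▸ hne.symm : (b.edge j).2 ≠ u), if_pos this]
    · have : b.Joined u (b.edge j).1 := .inr (by rw [← h]; exact hm)
      simp only [f, if_neg (h ▸ hne : (b.edge j).1 ≠ u), if_pos this]
  have main : ∀ {y : Fin (expand hk b).cells.length} {d : ℕ},
      (d : ℤ) ≤ |potential k b f ξ η x - potential k b f ξ η y| →
      (d : ℕ∞) ≤ (expand hk b).graph.edist x y := by
    refine fun hd => le_edist_of_potential hk f ξ η ?_ ?_ ?_ ?_ ?_ ?_ hd
    · intro j hj
      simp only [ξ]
      split_ifs with h1 h2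
      · rw [h1, hfu]; rfl
      · rw [(hfe j hj).2.1 h2]; simp
      · rfl
    · intro j hj
      simp only [ξ]
      split_ifs with h1 h2 h3
      · rw [(hfe j hj).1 h1]
      · rw [h2, hfu]; simp
      · omega
      · rfl
    · intro j hj i hi
      simp only [ξ]
      by_cases h1 : (b.edge j).1 = u
      · simp only [if_pos h1]; push_cast; rw [abs_le]; omega
      by_cases h2 : (b.edge j).2 = u
      · simp only [if_neg h1, if_pos h2]; push_cast; rw [abs_le]; omega
      have h3 := hf _ h1
      have h4 := hf _ h2
      simp only [if_neg h1, if_neg h2]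
      rw [abs_le]
      split_ifs <;> omega
    · intro j hj t ht
      simp only [η]
      split_ifs
      · rw [add_sub_add_left_eq_sub]
        refine (abs_abs_sub_abs_le _ _).trans ?_
        push_cast
        rw [abs_le]
        omega
      · simp
    · intro j hj
      simp only [ξ, η, sub_self, abs_zero]
      by_cases h1 : (b.edge j).1 = u
      · simp only [h1, true_or, if_true]; rw [abs_le]; omega
      by_cases h2 : (b.edge j).2 = u
      · simp only [h2, or_true, if_true, if_neg h1]; rw [abs_le]; omega
      have h3 := hf _ h1
      have h4 := hf _ h2
      simp only [h1, h2, or_self, if_false]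
      rw [abs_le]
      split_ifs <;> omega
    · intro j hj
      simp only [ξ, η, sub_self, abs_zero]
      by_cases h1 : (b.edge j).1 = u
      · simp only [h1, true_or, if_true]; rw [abs_le]; omega
      by_cases h2 : (b.edge j).2 = u
      · simp only [h2, or_true, if_true, if_neg h1]; rw [abs_le]; omega
      have h3 := hf _ h1
      have h4 := hf _ h2
      simp only [h1, h2, or_self, if_false]
      rw [abs_le]
      split_ifs <;> omega
  have hx0 : potential k b f ξ η x = 0 := by rw [hx, potential_of_lt hu, hfu]
  refine ⟨fun y hy hyu => ⟨main ?_, fun hj => main ?_⟩, fun y j p hy => main ?_⟩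
  · rw [hx0, potential_of_lt hy, zero_sub, abs_neg]
    rcases hf _ hyu with h | h <;> rw [h, abs_of_nonneg (by omega)]
    omega
  · rw [hx0, potential_of_lt hy, zero_sub, abs_neg]
    simp only [f, if_neg hyu, if_neg hj]
    rw [abs_of_nonneg (by omega)]
    push_cast; omega
  · rw [hx0, hy, potential_armVertex (by cases p <;> simp [armEnd]) hk, zero_sub, abs_neg]
    simp only [η]
    split_ifs
    · cases p
      · simp only [armEnd]
        rw [abs_of_nonpos (a := ((0 : ℕ) : ℤ) - _) (by push_cast; omega),
          abs_of_nonneg (by push_cast; omega)]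
        push_cast; omega
      · simp only [armEnd]
        rw [abs_of_nonneg (a := ((2 * ((k + 1) / 2) : ℕ) : ℤ) - _) (by push_cast; omega),
          abs_of_nonneg (by push_cast; omega)]
        push_cast; omega
    · rw [abs_of_nonneg (by omega)]
      push_cast; omega

/-- Lower bounds for the distances between the pieces of the gadgets. -/
theorem le_edist_armEnd (hk : 1 ≤ k) {x y : Fin (expand hk b).cells.length} {j j' : ℕ}
    {p q : Player} (hx : (x : ℕ) = armVertex k b j (armEnd k p))
    (hy : (y : ℕ) = armVertex k b j' (armEnd k q)) (hxy : x ≠ y) :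
    (k : ℕ∞) ≤ (expand hk b).graph.edist x y ∧
      (p = q → ((k + 1 : ℕ) : ℕ∞) ≤ (expand hk b).graph.edist x y) := by
  have hend : ∀ p, armEnd k p ≤ 2 * ((k + 1) / 2) := fun p => by cases p <;> simp [armEnd]
  -- The distance from `x`, cut off at `k + 1` outside its own gadget. The vertex number `i` of the
  -- path in place of the edge is at distance `⌈k / 2⌉ + 1 + (⌊k / 2⌋ - i)` or
  -- `⌈k / 2⌉ + 1 + (i - ⌈k / 2⌉)` from `x`.
  let f : ℕ → ℤ := fun _ => k + 1
  let ξ : ℕ → ℕ → ℤ := fun i₀ i =>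
    if i₀ = j then (if i ≤ k / 2 then k + 1 - i else i + 1) else k + 1
  let η : ℕ → ℕ → ℤ := fun i₀ t => if i₀ = j then |(t : ℤ) - armEnd k p| else k + 1
  have harm : |(((k + 1) / 2 : ℕ) : ℤ) - armEnd k p| = ((k + 1) / 2 : ℕ) := by
    cases p
    · simp only [armEnd, Nat.cast_zero, sub_zero]
      exact abs_of_nonneg (by omega)
    · simp only [armEnd]
      rw [abs_of_nonpos (by push_cast; omega)]
      push_cast; omega
  have main : ∀ {d : ℕ}, (d : ℤ) ≤ |potential k b f ξ η x - potential k b f ξ η y| →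
      (d : ℕ∞) ≤ (expand hk b).graph.edist x y := by
    refine fun hd => le_edist_of_potential hk f ξ η ?_ ?_ ?_ ?_ ?_ ?_ hd
    · intro i₀ _
      simp [ξ, f]
    · intro i₀ _
      simp only [ξ, f]
      split_ifs <;> omega
    · intro i₀ _ i hi
      simp only [ξ]
      rw [abs_le]
      push_cast
      split_ifs <;> omega
    · intro i₀ _ t _
      simp only [η]
      split_ifs
      · refine (abs_abs_sub_abs_le _ _).trans ?_
        push_cast
        rw [abs_le]
        omega
      · simp
    · intro i₀ _
      simp only [ξ, η]
      split_ifs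
      · rw [harm, abs_le]; omega
      · omega
      · simp
    · intro i₀ _
      simp only [ξ, η]
      split_ifs
      · rw [harm, abs_le]; omega
      · rw [harm, abs_le]; omega
      · simp
  have hx0 : potential k b f ξ η x = 0 := by
    rw [hx, potential_armVertex (hend p) hk]
    simp [η]
  have hy0 : potential k b f ξ η y =
      if j' = j then |(armEnd k q : ℤ) - armEnd k p| else k + 1 := by
    rw [hy, potential_armVertex (hend q) hk]
  rw [hx0, hy0, zero_sub] at main
  by_cases hj : j' = j
  · subst hj
    have hpq : p ≠ q := by
      rintro rfl
      exact hxy (Fin.ext (hx.trans hy.symm))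
    refine ⟨main ?_, fun h => absurd h hpq⟩
    rw [if_pos rfl, abs_neg, abs_abs]
    cases p <;> cases q <;> first | exact absurd rfl hpq | skip
    · simp only [armEnd]
      rw [abs_of_nonneg (by push_cast; omega)]
      push_cast; omega
    · simp only [armEnd]
      rw [abs_of_nonpos (by push_cast; omega)]
      push_cast; omega
  · refine ⟨main ?_, fun _ => main ?_⟩
    · rw [if_neg hj, abs_neg, abs_of_nonneg (by omega)]
      omega
    · rw [if_neg hj, abs_neg, abs_of_nonneg (by omega)]
      push_cast; omega

theorem edist_pathVertex_le (hk : 1 ≤ k) {j i i' : ℕ} (hj : j < b.edges.length) (hi : i ≤ i')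
    (hi' : i' ≤ k) {x y : Fin (expand hk b).cells.length} (hx : (x : ℕ) = pathVertex k b j i)
    (hy : (y : ℕ) = pathVertex k b j i') :
    (expand hk b).graph.edist x y ≤ (i' - i : ℕ) :=
  Board.edist_le_of_chain (f := pathVertex k b j) (n := k)
    (fun i hi => (mem_expandEdges k b).2 ⟨j, hj, .inl ⟨i, hi, rfl⟩⟩) hi hi' hx hy

theorem edist_armVertex_le (hk : 1 ≤ k) {j t t' : ℕ} (hj : j < b.edges.length) (ht : t ≤ t')
    (ht' : t' ≤ 2 * ((k + 1) / 2)) {x y : Fin (expand hk b).cells.length}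
    (hx : (x : ℕ) = armVertex k b j t) (hy : (y : ℕ) = armVertex k b j t') :
    (expand hk b).graph.edist x y ≤ (t' - t : ℕ) :=
  Board.edist_le_of_chain (f := armVertex k b j) (n := 2 * ((k + 1) / 2))
    (fun t ht => (mem_expandEdges k b).2 ⟨j, hj, .inr (.inl ⟨t, ht, rfl⟩)⟩) ht ht' hx hy

theorem edist_armVertex_armEnd_le (hk : 1 ≤ k) {j t : ℕ} (hj : j < b.edges.length)
    (ht : t ≤ 2 * ((k + 1) / 2)) {p : Player}
    {x y : Fin (expand hk b).cells.length} (hx : (x : ℕ) = armVertex k b j t)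
    (hy : (y : ℕ) = armVertex k b j (armEnd k p)) :
    (expand hk b).graph.edist x y ≤ (max t (2 * ((k + 1) / 2) - t) : ℕ) := by
  cases p
  · rw [SimpleGraph.edist_comm]
    refine (edist_armVertex_le hk hj (Nat.zero_le t) ht hy hx).trans ?_
    rw [Nat.cast_le]
    omega
  · refine (edist_armVertex_le hk hj ht le_rfl hx hy).trans ?_
    rw [Nat.cast_le]
    omega

/-- The inner vertices of the path in place of an edge are at distance at most `k` from both pieces
of the gadget: the middle of the second path is at distance `⌈k / 2⌉` from these, and at distance at
most `⌊k / 2⌋` from the inner vertices. -/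
theorem edist_pathVertex_armEnd_le (hk : 1 ≤ k) {j i : ℕ} (hj : j < b.edges.length) (hi : 0 < i)
    (hik : i < k) {p : Player} {x y : Fin (expand hk b).cells.length}
    (hx : (x : ℕ) = pathVertex k b j i) (hy : (y : ℕ) = armVertex k b j (armEnd k p)) :
    (expand hk b).graph.edist x y ≤ k := by
  have hmid : ∀ c, c = k / 2 ∨ c = (k + 1) / 2 →
      (pathVertex k b j c, armVertex k b j ((k + 1) / 2)) ∈ (expand hk b).edges := by
    rintro c (rfl | rfl)
    · exact (mem_expandEdges k b).2 ⟨j, hj, .inr (.inr (.inl rfl))⟩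
    · exact (mem_expandEdges k b).2 ⟨j, hj, .inr (.inr (.inr rfl))⟩
  -- The route through the vertex number `c` of the path, if that is at distance `d`.
  have key : ∀ c d : ℕ, c = k / 2 ∨ c = (k + 1) / 2 → d + 1 + (k + 1) / 2 ≤ k →
      (∀ z : Fin (expand hk b).cells.length, (z : ℕ) = pathVertex k b j c →
        (expand hk b).graph.edist x z ≤ (d : ℕ)) → (expand hk b).graph.edist x y ≤ k := by
    intro c d hc hle hz
    have hv := (expand hk b).edges_valid _ (hmid c hc)
    let z : Fin (expand hk b).cells.length := ⟨_, hv.1⟩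
    let m : Fin (expand hk b).cells.length := ⟨_, hv.2.1⟩
    have h1 := hz z rfl
    have h2 : (expand hk b).graph.edist z m ≤ 1 := Board.edist_le_one (hmid c hc)
    have h3 := edist_armVertex_armEnd_le hk hj (t := (k + 1) / 2) (by omega) (x := m) rfl hy
    calc (expand hk b).graph.edist x y
        ≤ (expand hk b).graph.edist x z + (expand hk b).graph.edist z y :=
          SimpleGraph.edist_triangle
      _ ≤ (expand hk b).graph.edist x z +
          ((expand hk b).graph.edist z m + (expand hk b).graph.edist m y) := by
          gcongr
          exact SimpleGraph.edist_triangle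
      _ ≤ (d : ℕ) + (1 + (max ((k + 1) / 2) (2 * ((k + 1) / 2) - (k + 1) / 2) : ℕ)) := by
          gcongr
      _ ≤ k := by
          rw [← Nat.cast_one (R := ℕ∞), ← Nat.cast_add, ← Nat.cast_add, Nat.cast_le]
          omega
  rcases le_or_gt i (k / 2) with h | h
  · exact key (k / 2) (k / 2 - i) (.inl rfl) (by omega) fun z hz =>
      edist_pathVertex_le hk hj h (by omega) hx hz
  · refine key ((k + 1) / 2) (i - (k + 1) / 2) (.inr rfl) (by omega) fun z hz => ?_
    rw [SimpleGraph.edist_comm]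
    exact edist_pathVertex_le hk hj (by omega) (by omega) hz hx

end Distances

/-! ### The reduction -/

section Reduction

variable {k : ℕ} {b : Board}

theorem expand_pieces_of_lt (hk : 1 ≤ k) {x : Fin (expand hk b).cells.length}
    (hx : (x : ℕ) < b.cells.length) : (expand hk b).pieces x = b.pieces ⟨x, hx⟩ := by
  simp only [Board.pieces, expand, replaceCells, List.get_eq_getElem]
  exact List.getElem_append_left hx

theorem expand_pieces_gadgetBase_add (hk : 1 ≤ k) {x : Fin (expand hk b).cells.length} {j a : ℕ}
    (hj : j < b.edges.length) (ha : a < (gadgetCells k).length)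
    (hx : (x : ℕ) = gadgetBase k b j + a) : (expand hk b).pieces x =
      if a = k - 1 + armEnd k .left then some .left
      else if a = k - 1 + armEnd k .right then some .right else none := by
  have h1 : some ((expand hk b).pieces x) = (gadgetCells k)[a]? := by
    rw [← getElem?_flatten_replicate _ hj ha,
      show (gadgetCells k).length * j + a = x - b.cells.length by rw [hx, gadgetBase]; omega,
      ← List.getElem?_append_right (l₁ := b.cells) (by rw [hx, gadgetBase]; omega)]
    exact (List.getElem?_eq_getElem x.isLt).symm
  rw [length_gadgetCells] at ha
  rw [gadgetCells, List.getElem?_map, List.getElem?_range ha, Option.map_some,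
    Option.some.injEq] at h1
  exact h1

/-- A new vertex is an inner vertex of a path in place of an edge, or a vertex of the second path of
a gadget. -/
theorem exists_of_le (hk : 1 ≤ k) {x : Fin (expand hk b).cells.length}
    (hx : b.cells.length ≤ x) : ∃ j < b.edges.length,
      (∃ i, 0 < i ∧ i < k ∧ (x : ℕ) = pathVertex k b j i ∧ (expand hk b).pieces x = none) ∨
      (∃ p, (x : ℕ) = armVertex k b j (armEnd k p) ∧ (expand hk b).pieces x = some p) ∨
      (∃ t, 0 < t ∧ t < 2 * ((k + 1) / 2) ∧ (x : ℕ) = armVertex k b j t ∧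
        (expand hk b).pieces x = none) := by
  have hlen := length_gadgetCells k
  have hx' : (x : ℕ) < b.cells.length + (gadgetCells k).length * b.edges.length := by
    rw [← length_replaceCells]
    exact x.isLt
  have hpos : 0 < (gadgetCells k).length := by omega
  let j := (x - b.cells.length) / (gadgetCells k).length
  let a := (x - b.cells.length) % (gadgetCells k).length
  have ha : a < (gadgetCells k).length := Nat.mod_lt _ hpos
  have hja : (gadgetCells k).length * j + a = x - b.cells.length := Nat.div_add_mod _ _
  have hj : j < b.edges.length := by
    rw [Nat.div_lt_iff_lt_mul hpos, Nat.mul_comm]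
    omega
  have hxja : (x : ℕ) = gadgetBase k b j + a := by
    rw [gadgetBase]; omega
  have hpiece := expand_pieces_gadgetBase_add hk hj ha hxja
  -- The first `k - 1` new vertices of a gadget form the path, the others the second path.
  refine ⟨j, hj, ?_⟩
  by_cases h1 : a < k - 1
  · refine .inl ⟨a + 1, by omega, by omega, ?_, ?_⟩
    · rw [pathVertex_of_pos (by omega) (by omega), hxja, Nat.add_sub_cancel]
    · rw [hpiece, if_neg (by omega), if_neg (by omega)]
  by_cases h2 : a = k - 1 + armEnd k .left
  · refine .inr (.inl ⟨.left, ?_, ?_⟩)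
    · rw [armVertex_eq, hxja, h2]
    · rw [hpiece, if_pos h2]
  by_cases h3 : a = k - 1 + armEnd k .right
  · refine .inr (.inl ⟨.right, ?_, ?_⟩)
    · rw [armVertex_eq, hxja, h3]
    · rw [hpiece, if_neg h2, if_pos h3]
  · rw [if_neg h2, if_neg h3] at hpiece
    simp only [armEnd] at h2 h3
    refine .inr (.inr ⟨a - (k - 1), by omega, by omega, ?_, hpiece⟩)
    rw [armVertex_eq, hxja]
    omega

/-- The original vertices among those of the board with gadgets. -/
def expandEmb (hk : 1 ≤ k) (b : Board) (v : Fin b.cells.length) :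
    Fin (expand hk b).cells.length :=
  ⟨v, v.isLt.trans_le ((length_replaceCells ..).symm ▸ Nat.le_add_right _ _)⟩

theorem expandEmb_injective (hk : 1 ≤ k) : (expandEmb hk b).Injective := fun _ _ h =>
  Fin.ext (congrArg Fin.val h :)

/-- The pieces of the gadgets. -/
def gadgetPieces (hk : 1 ≤ k) (b : Board) (x : Fin (expand hk b).cells.length) : Option Player :=
  if (x : ℕ) < b.cells.length then none else (expand hk b).pieces x

theorem mem_range_expandEmb_iff (hk : 1 ≤ k) {x : Fin (expand hk b).cells.length} :
    x ∈ Set.range (expandEmb hk b) ↔ (x : ℕ) < b.cells.length :=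
  ⟨by rintro ⟨v, rfl⟩; exact v.isLt, fun h => ⟨⟨x, h⟩, rfl⟩⟩

theorem exists_of_gadgetPieces (hk : 1 ≤ k) {x : Fin (expand hk b).cells.length} {p : Player}
    (hx : gadgetPieces hk b x = some p) :
    ∃ j < b.edges.length, (x : ℕ) = armVertex k b j (armEnd k p) := by
  rw [gadgetPieces] at hx
  split_ifs at hx with h
  obtain ⟨j, hj, ⟨_, _, _, _, h⟩ | ⟨q, hq, h⟩ | ⟨_, _, _, _, h⟩⟩ := exists_of_le hk (not_lt.1 h)
  · rw [hx] at h; cases h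
  · rw [hx, Option.some.injEq] at h
    exact ⟨j, hj, by rw [h]; exact hq⟩
  · rw [hx] at h; cases h

theorem exists_gadgetPiece (hk : 1 ≤ k) {j : ℕ} (hj : j < b.edges.length) (p : Player) :
    ∃ y : Fin (expand hk b).cells.length, y ∉ Set.range (expandEmb hk b) ∧
      gadgetPieces hk b y = some p ∧ (y : ℕ) = armVertex k b j (armEnd k p) := by
  have hlen := length_gadgetCells k
  have hend : armEnd k p ≤ 2 * ((k + 1) / 2) := by cases p <;> simp [armEnd]
  have ha : k - 1 + armEnd k p < (gadgetCells k).length := by omega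
  let y : Fin (expand hk b).cells.length :=
    ⟨armVertex k b j (armEnd k p), (gadgetBase_add_lt hj ha).trans_eq (length_replaceCells ..).symm⟩
  have hy : ¬ (y : ℕ) < b.cells.length := by
    change ¬ gadgetBase k b j + _ < b.cells.length
    rw [gadgetBase]
    omega
  refine ⟨y, (mem_range_expandEmb_iff hk).not.2 hy, ?_, rfl⟩
  rw [gadgetPieces, if_neg hy, expand_pieces_gadgetBase_add hk hj ha rfl]
  cases p
  · rw [if_pos rfl]
  · rw [if_neg (by simp only [armEnd]; omega), if_pos rfl]

theorem extend_gadgetPieces (hk : 1 ≤ k) (b : Board) :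
    Function.extend (expandEmb hk b) b.pieces (gadgetPieces hk b) = (expand hk b).pieces := by
  have hinj : (expandEmb hk b).Injective := expandEmb_injective hk
  funext x
  by_cases hx : (x : ℕ) < b.cells.length
  · rw [expand_pieces_of_lt hk hx]
    exact hinj.extend_apply _ _ (⟨x, hx⟩ : Fin b.cells.length)
  · rw [Function.extend_apply' _ _ _ (by
      simpa using (mem_range_expandEmb_iff hk).not.2 hx), gadgetPieces, if_neg hx]

theorem isBlockedEmbedding_expand (hk : 1 ≤ k) (b : Board) :
    IsBlockedEmbedding k b.graph (expand hk b).graph (expandEmb hk b) (gadgetPieces hk b) where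
  injective := expandEmb_injective hk
  edist_of_adj := by
    intro u v huv
    have key : ∀ u v : Fin b.cells.length, ((u : ℕ), (v : ℕ)) ∈ b.edges →
        (expand hk b).graph.edist (expandEmb hk b u) (expandEmb hk b v) ≤ k := by
      intro u v huv
      obtain ⟨j, hj, he⟩ := b.exists_edge huv
      refine edist_pathVertex_le hk hj (Nat.zero_le k) le_rfl ?_ ?_
      · rw [pathVertex_zero, he]; rfl
      · rw [pathVertex_self hk, he]; rfl
    refine le_antisymm ?_ ?_
    · rcases (b.adj_iff u v).1 huv with h | h
      · exact key u v h
      · rw [SimpleGraph.edist_comm]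
        exact key v u h
    · exact ((le_edist_original hk rfl u.isLt).1 (expandEmb hk b v) v.isLt
        fun h => huv.ne (Fin.ext h.symm)).1
  lt_edist_of_not_adj := by
    intro u v huv hadj
    refine (Nat.cast_lt.2 k.lt_succ_self).trans_le
      (((le_edist_original hk rfl u.isLt).1 (expandEmb hk b v) v.isLt
        fun h => huv (Fin.ext h.symm)).2 fun h => hadj ((b.adj_iff u v).2 h))
  lt_edist_blk := by
    intro u w p hw
    obtain ⟨j, hj, hw⟩ := exists_of_gadgetPieces hk hw
    exact (Nat.cast_lt.2 k.lt_succ_self).trans_le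
      ((le_edist_original hk rfl u.isLt).2 w j p hw)
  le_edist_blk := by
    intro w w' p q hw hw' hne
    obtain ⟨j, hj, hw⟩ := exists_of_gadgetPieces hk hw
    obtain ⟨j', hj', hw'⟩ := exists_of_gadgetPieces hk hw'
    exact (le_edist_armEnd hk hw hw' hne).1
  lt_edist_blk_same := by
    intro w w' p hw hw' hne
    obtain ⟨j, hj, hw⟩ := exists_of_gadgetPieces hk hw
    obtain ⟨j', hj', hw'⟩ := exists_of_gadgetPieces hk hw'
    exact (Nat.cast_lt.2 k.lt_succ_self).trans_le ((le_edist_armEnd hk hw hw' hne).2 rfl)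
  blocked := by
    intro w hr hw p
    have hw' : ¬ (w : ℕ) < b.cells.length := (mem_range_expandEmb_iff hk).not.1 hr
    obtain ⟨j, hj, h⟩ := exists_of_le hk (not_lt.1 hw')
    obtain ⟨y, hy, hyp, hyj⟩ := exists_gadgetPiece hk hj p
    refine ⟨y, hy, hyp, ?_⟩
    rcases h with ⟨i, hi, hik, hwi, -⟩ | ⟨q, -, hq⟩ | ⟨t, ht, hth, hwt, -⟩
    · exact edist_pathVertex_armEnd_le hk hj hi hik hwi hyj
    · rw [gadgetPieces, if_neg hw', hq] at hw
      cases hw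
    · refine (edist_armVertex_armEnd_le hk hj hth.le hwt hyj).trans ?_
      rw [Nat.cast_le]
      omega

/-- The reduction of Col to the distance game: the edges of the board are replaced by gadgets. -/
def reduction (hk : 1 ≤ k) {D : Set ℕ} (hD : ∀ d ∈ D, d < k) (b : Position ∅ {1}) :
    Position D (Set.Icc 1 k) :=
  ⟨expand hk b.1, by
    rw [← extend_gadgetPieces, (isBlockedEmbedding_expand hk b.1).isLegal_extend_iff hk hD]
    exact b.2⟩

theorem winsMovingNext_reduction_iff (hk : 1 ≤ k) {D : Set ℕ} (hD : ∀ d ∈ D, d < k)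
    (b : Position ∅ {1}) :
    (distanceGame D (Set.Icc 1 k)).Yes (reduction hk hD b) ↔ col.Yes b := by
  change WinsMovingNext D (Set.Icc 1 k) (expand hk b.1).graph .left (expand hk b.1).pieces ↔
    WinsMovingNext ∅ {1} b.1.graph .left b.1.pieces
  rw [← extend_gadgetPieces,
    (isBlockedEmbedding_expand hk b.1).winsMovingNext_extend_iff hk hD]

end Reduction

end DistanceGame

theorem mainTheorem7 (hCol : Complexity.PSPACEHard DistanceGame.col)
    (k : ℕ) (hk : 1 ≤ k) (D : Set ℕ) (hDS : D ⊆ Set.Icc 1 k) (hmax : ∀ d ∈ D, d < k) :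
    Complexity.PSPACEHard (DistanceGame.distanceGame D (Set.Icc 1 k)) := by
  intro L hL
  obtain ⟨f, ⟨hf⟩, hyes⟩ := hCol L hL
  obtain ⟨hg⟩ := DistanceGame.nonempty_computableInPolyTime_replace (DistanceGame.gadgetCells k)
    (DistanceGame.gadget k) (DistanceGame.reduction hk hmax) (fun _ => rfl) fun _ => rfl
  refine ⟨DistanceGame.reduction hk hmax ∘ f,
    Complexity.nonempty_computableInPolyTime_comp hf hg, fun w => ?_⟩
  exact (hyes w).trans (DistanceGame.winsMovingNext_reduction_iff hk hmax (f w)).symm
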